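/- **Conventions.** A modal Riesz space is a triple $(A,u,\Diamond)$ where $A$ is a real Riesz space (vector lattice), $u\ge 0$ is a distinguished element of $A$, and $\Diamond:A\to A$ is linear, positive ($\Diamond(a\sqcup 0)\ge 0$ for all $a$) and $u$-decreasing ($\Diamond u\le u$). Morphisms are linear lattice homomorphisms preserving $u$ and $\Diamond$. An element $a$ is infinitely small if there is $b$ with $n|a|\le|b|$ for all $n\in\mathbb N$; $A$ is Archimedean if $0$ is its only infinitely small element, unital if $u$ is a strong unit (for each $a$ there is $n\in\mathbb N$ with $|a|\le nu$), and uniformly complete if every $u$-uniformly Cauchy sequence converges $u$-uniformly. Let $\mathbf{AURiesz}_\Diamond$ be the category of Archimedean unital modal Riesz spaces, and $\mathbf{CAURiesz}_\Diamond$ its full subcategory of uniformly complete ones. For a compact Hausdorff space $X$ let $\mathcal R^{\le1}(X)$ be the set of Radon subprobability measures on $X$ with the weak-* topology (the coarsest one making $\mu\mapsto\int f\,d\mu$ continuous for every $f\in C(X)$); with pushforward of measures it is an endofunctor of the category of compact Hausdorff spaces. A Markov process is a coalgebra of it, i.e. a continuous map $\alpha:X\to\mathcal R^{\le1}(X)$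 with $X$ compact Hausdorff; $\mathbf{Markov}$ is the category of these coalgebras and coalgebra morphisms. To a Markov process $\alpha$ on $X$ corresponds the object $C^\Diamond(\alpha)=(C(X),\mathbf 1_X,\Diamond_\alpha)$ of $\mathbf{CAURiesz}_\Diamond$, where $\Diamond_\alpha(f)(x)=\int f\,d\alpha(x)$. For $A\in\mathbf{AURiesz}_\Diamond$ let $\mathrm{Spec}(A)$ be the set of maximal ideals of $A$ (maximal among the ideals different from $A$) with the hull-kernel topology, a compact Hausdorff space. For $a\in A$ let $\hat a\in C(\mathrm{Spec}(A))$ be given by: $\hat a(J)$ is the unique real $r$ with $ru-a\in J$. Let $\mathrm{Spec}^\Diamond(A)$ be the Markov process $\alpha_\Diamond$ on $\mathrm{Spec}(A)$ for which $\alpha_\Diamond(J)$ is the unique Radon subprobability measure with $\int\hat a\,d\alpha_\Diamond(J)=\widehat{\Diamond a}(J)$ for all $a\in A$. Let $\mathbb I$ be the modal Riesz space of closed terms in the signature $\{0,+,(r)_{r\in\mathbb R},\sqcup,\sqcap,1,\Diamond\}$ modulo provable equality (in equational logic) from the axioms of modal Riesz spaces, with $1$ interpreted as the distinguished element. Let $\mathbb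 I_a\in\mathbf{AURiesz}_\Diamond$ be the quotient of $\mathbb I$ that identifies $a$ and $b$ whenever $a-b$ is infinitely small, and let $\hat{\mathbb I}_a=C^\Diamond(\mathrm{Spec}^\Diamond(\mathbb I_a))$ be its uniform completion. **Proposition 5.7 (initiality).** The uniformly complete modal Riesz space $\hat{\mathbb I}_a$ is an initial object of $\mathbf{CAURiesz}_\Diamond$. Dually, $\mathrm{Spec}^\Diamond(\mathbb I_a)$ is a final coalgebra, that is, a terminal object of $\mathbf{Markov}$. -/

import Mathlib

open CategoryTheory MeasureTheory

universe u

set_option linter.unusedSectionVars false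

namespace ModalRieszDuality

/-! ### Riesz spaces

A Riesz space is a real vector space with a lattice order compatible with the vector space
structure. We use Mathlib's classes: `[AddCommGroup A] [Lattice A] [IsOrderedAddMonoid A]
[Module ℝ A] [IsOrderedModule ℝ A]`. -/

section Riesz

variable {A : Type u} [AddCommGroup A] [Lattice A] [IsOrderedAddMonoid A] [Module ℝ A]

/-- `u` is a strong unit: it is positive and every element is dominated by a multiple of it. -/
def IsStrongUnit (u : A) : Prop := 0 ≤ u ∧ ∀ a : A, ∃ n : ℕ, |a| ≤ n • u

/-- `a` is infinitely small: for some `b`, `n |a| ≤ |b|` for all natural numbers `n`. -/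
def IsInfinitelySmall (a : A) : Prop := ∃ b : A, ∀ n : ℕ, n • |a| ≤ |b|

variable (A) in
/-- The Archimedean property: `0` is the only infinitely small element. -/
def IsArchimedeanRiesz : Prop := ∀ a : A, IsInfinitelySmall a → a = 0

/-- The sequence `a` converges `u`-uniformly to `b`. -/
def UnifConverges (u : A) (a : ℕ → A) (b : A) : Prop :=
  ∀ ε : ℝ, 0 < ε → ∃ N : ℕ, ∀ n > N, |b - a n| ≤ ε • u

/-- The sequence `a` is `u`-uniformly Cauchy. -/
def UnifCauchy (u : A) (a : ℕ → A) : Prop :=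
  ∀ ε : ℝ, 0 < ε → ∃ N : ℕ, ∀ i > N, ∀ j > N, |a i - a j| ≤ ε • u

/-- `u`-uniform completeness. -/
def IsUnifComplete (u : A) : Prop :=
  ∀ a : ℕ → A, UnifCauchy u a → ∃ b : A, UnifConverges u a b

/-- A (Riesz) ideal: a solid linear subspace, i.e. `a ∈ J` and `|b| ≤ |a|` imply `b ∈ J`. -/
def IsRieszIdeal (J : Submodule ℝ A) : Prop := ∀ ⦃a b : A⦄, a ∈ J → |b| ≤ |a| → b ∈ J

variable (A) in
/-- The spectrum of a Riesz space: the set of its maximal ideals, that is, of the ideals that are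
maximal among the ideals different from the whole space. -/
@[ext]
structure Spec where
  ideal : Submodule ℝ A
  isRieszIdeal : IsRieszIdeal ideal
  ne_top : ideal ≠ ⊤
  maximal : ∀ K : Submodule ℝ A, IsRieszIdeal K → K ≠ ⊤ → ideal ≤ K → K = ideal

/-- The hull of an ideal `I`: the set of all maximal ideals that contain `I`. -/
def hull (I : Submodule ℝ A) : Set (Spec A) := {J | I ≤ J.ideal}

theorem IsRieszIdeal.abs_mem {J : Submodule ℝ A} (hJ : IsRieszIdeal J) {a : A} (ha : a ∈ J) :
    |a| ∈ J := hJ ha (by rw [abs_abs])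

theorem IsRieszIdeal.of_le {J : Submodule ℝ A} (hJ : IsRieszIdeal J) {a b : A} (ha : a ∈ J)
    (hb : 0 ≤ b) (h : b ≤ a) : b ∈ J :=
  hJ ha (by rwa [abs_of_nonneg hb, abs_of_nonneg (hb.trans h)])

theorem IsRieszIdeal.sInf {S : Set (Submodule ℝ A)} (hS : ∀ J ∈ S, IsRieszIdeal J) :
    IsRieszIdeal (sInf S) := by
  intro a b ha hb
  rw [Submodule.mem_sInf] at ha ⊢
  exact fun J hJ => hS J hJ (ha J hJ) hb

theorem IsRieszIdeal.top : IsRieszIdeal (⊤ : Submodule ℝ A) := fun _ _ _ _ => trivial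

theorem IsRieszIdeal.inf {I J : Submodule ℝ A} (hI : IsRieszIdeal I) (hJ : IsRieszIdeal J) :
    IsRieszIdeal (I ⊓ J) := fun _ _ ha hb => ⟨hI ha.1 hb, hJ ha.2 hb⟩

variable [IsOrderedModule ℝ A]

theorem abs_smul_le (r : ℝ) (a : A) : |r • a| ≤ |r| • |a| := by
  rw [abs_le']
  constructor
  · rcases le_total 0 r with h | h
    · rw [abs_of_nonneg h]; exact smul_le_smul_of_nonneg_left (le_abs_self a) h
    · rw [abs_of_nonpos h, ← neg_smul_neg]
      exact smul_le_smul_of_nonneg_left (neg_le_abs a) (by linarith)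
  · rcases le_total 0 r with h | h
    · rw [abs_of_nonneg h, ← smul_neg]; exact smul_le_smul_of_nonneg_left (neg_le_abs a) h
    · rw [abs_of_nonpos h, ← neg_smul]
      exact smul_le_smul_of_nonneg_left (le_abs_self a) (by linarith)

/-- The ideal generated by an ideal `J` and an element `x`. -/
def adjoin (J : Submodule ℝ A) (hJ : IsRieszIdeal J) (x : A) : Submodule ℝ A where
  carrier := {b | ∃ j ∈ J, ∃ r : ℝ, 0 ≤ r ∧ |b| ≤ |j| + r • |x|}
  zero_mem' := ⟨0, J.zero_mem, 0, le_rfl, by simp⟩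
  add_mem' := by
    rintro a b ⟨j, hj, r, hr, h⟩ ⟨k, hk, s, hs, h'⟩
    refine ⟨|j| + |k|, J.add_mem (hJ.abs_mem hj) (hJ.abs_mem hk), r + s, by positivity, ?_⟩
    rw [abs_of_nonneg (add_nonneg (abs_nonneg j) (abs_nonneg k)), add_smul, add_add_add_comm]
    exact (abs_add_le a b).trans (add_le_add h h')
  smul_mem' := by
    rintro c a ⟨j, hj, r, hr, h⟩
    refine ⟨|c| • |j|, J.smul_mem _ (hJ.abs_mem hj), |c| * r, by positivity, ?_⟩
    rw [abs_of_nonneg (smul_nonneg (abs_nonneg c) (abs_nonneg j)), mul_smul, ← smul_add]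
    exact (abs_smul_le c a).trans (smul_le_smul_of_nonneg_left h (abs_nonneg c))

theorem isRieszIdeal_adjoin (J : Submodule ℝ A) (hJ : IsRieszIdeal J) (x : A) :
    IsRieszIdeal (adjoin J hJ x) := by
  rintro a b ⟨j, hj, r, hr, h⟩ hb
  exact ⟨j, hj, r, hr, hb.trans h⟩

theorem le_adjoin (J : Submodule ℝ A) (hJ : IsRieszIdeal J) (x : A) : J ≤ adjoin J hJ x :=
  fun j hj => ⟨j, hj, 0, le_rfl, by simp⟩

theorem self_mem_adjoin (J : Submodule ℝ A) (hJ : IsRieszIdeal J) (x : A) :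
    x ∈ adjoin J hJ x := ⟨0, J.zero_mem, 1, zero_le_one, by simp⟩

theorem Spec.exists_le (M : Spec A) {x : A} (hx : x ∉ M.ideal) (b : A) :
    ∃ j ∈ M.ideal, 0 ≤ j ∧ ∃ r : ℝ, 0 ≤ r ∧ |b| ≤ j + r • |x| := by
  by_cases h : adjoin M.ideal M.isRieszIdeal x = ⊤
  · have hb : b ∈ adjoin M.ideal M.isRieszIdeal x := h ▸ trivial
    obtain ⟨j, hj, r, hr, h⟩ := hb
    exact ⟨|j|, M.isRieszIdeal.abs_mem hj, abs_nonneg j, r, hr, h⟩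
  · have := M.maximal _ (isRieszIdeal_adjoin _ _ x) h (le_adjoin _ _ x)
    exact absurd (this ▸ self_mem_adjoin M.ideal M.isRieszIdeal x) hx

theorem inf_add_le {x y z : A} (hx : 0 ≤ x) (hy : 0 ≤ y) (hz : 0 ≤ z) :
    x ⊓ (y + z) ≤ x ⊓ y + x ⊓ z := by
  have h1 : x ⊓ (y + z) - x ⊓ z ≤ x := by
    have : 0 ≤ x ⊓ z := le_inf hx hz
    exact (sub_le_self _ this).trans inf_le_left
  have h2 : x ⊓ (y + z) - x ⊓ z ≤ y := by
    rw [sub_le_iff_le_add, add_inf]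
    exact le_inf (inf_le_left.trans (le_add_of_nonneg_left hy)) inf_le_right
  rw [← sub_le_iff_le_add]
  exact le_inf h1 h2

theorem inf_smul_le {x y : A} (hx : 0 ≤ x) (hy : 0 ≤ y) {r : ℝ} (hr : 0 ≤ r) :
    x ⊓ (r • y) ≤ (r + 1) • (x ⊓ y) := by
  have hxy : 0 ≤ x ⊓ y := le_inf hx hy
  have h1 : (r + 1)⁻¹ • (x ⊓ (r • y)) ≤ x ⊓ y := by
    have hr1 : (0 : ℝ) ≤ (r + 1)⁻¹ := by positivity
    have hr2 : (r + 1)⁻¹ ≤ 1 := inv_le_one_of_one_le₀ (by linarith)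
    refine le_inf ?_ ?_
    · calc _ ≤ (r + 1)⁻¹ • x := smul_le_smul_of_nonneg_left inf_le_left hr1
        _ ≤ (1 : ℝ) • x := smul_le_smul_of_nonneg_right hr2 hx
        _ = x := one_smul _ _
    · calc _ ≤ (r + 1)⁻¹ • (r • y) := smul_le_smul_of_nonneg_left inf_le_right hr1
        _ = ((r + 1)⁻¹ * r) • y := (mul_smul _ _ _).symm
        _ ≤ (1 : ℝ) • y := smul_le_smul_of_nonneg_right
            (by rw [inv_mul_le_iff₀ (by linarith)]; linarith) hy
        _ = y := one_smul _ _
  calc x ⊓ (r • y) = (r + 1) • ((r + 1)⁻¹ • (x ⊓ (r • y))) := by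
        rw [smul_smul, mul_inv_cancel₀ (by linarith), one_smul]
    _ ≤ _ := smul_le_smul_of_nonneg_left h1 (by linarith)

theorem Spec.prime (M : Spec A) {x y : A} (hx : 0 ≤ x) (hy : 0 ≤ y) (h : x ⊓ y ∈ M.ideal) :
    x ∈ M.ideal ∨ y ∈ M.ideal := by
  by_contra! hc
  obtain ⟨j, hj, hj0, r, hr, h1⟩ := M.exists_le hc.1 y
  apply hc.2
  rw [abs_of_nonneg hy, abs_of_nonneg hx] at h1
  refine M.isRieszIdeal.of_le (a := j + (r + 1) • (x ⊓ y))
    (M.ideal.add_mem hj (M.ideal.smul_mem _ h)) hy ?_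
  calc y = y ⊓ (j + r • x) := (inf_eq_left.2 h1).symm
    _ ≤ y ⊓ j + y ⊓ (r • x) := inf_add_le hy hj0 (smul_nonneg hr hx)
    _ ≤ j + (r + 1) • (y ⊓ x) := add_le_add inf_le_right (inf_smul_le hy hx hr)
    _ = _ := by rw [inf_comm]

/-- The hull-kernel topology: the closed sets are the hulls of (not necessarily maximal) ideals. -/
instance : TopologicalSpace (Spec A) :=
  TopologicalSpace.ofClosed {X | ∃ I : Submodule ℝ A, IsRieszIdeal I ∧ X = hull I}
    ⟨⊤, IsRieszIdeal.top, by
      refine (Set.eq_empty_of_forall_notMem fun J hJ => J.ne_top ?_).symm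
      exact top_le_iff.1 hJ⟩
    (by
      intro T hT
      refine ⟨sInf {K | IsRieszIdeal K ∧ ∀ I, IsRieszIdeal I → hull I ∈ T → I ≤ K},
        IsRieszIdeal.sInf fun K hK => hK.1, ?_⟩
      ext J
      constructor
      · intro hJ
        exact sInf_le (a := J.ideal) ⟨J.isRieszIdeal, fun I _ hI => hJ _ hI⟩
      · rintro hJ X hX
        obtain ⟨I, hI, rfl⟩ := hT hX
        exact le_trans (le_sInf (a := I) fun K hK => hK.2 I hI hX) (show _ ≤ J.ideal from hJ))
    (by
      rintro _ ⟨I, hI, rfl⟩ _ ⟨K, hK, rfl⟩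
      refine ⟨I ⊓ K, hI.inf hK, ?_⟩
      ext J
      constructor
      · rintro (h | h)
        · exact inf_le_left.trans (show I ≤ J.ideal from h)
        · exact inf_le_right.trans (show K ≤ J.ideal from h)
      · intro h
        by_contra hc
        obtain ⟨h1, h2⟩ : ¬ I ≤ J.ideal ∧ ¬ K ≤ J.ideal :=
          ⟨fun h' => hc (Or.inl h'), fun h' => hc (Or.inr h')⟩
        obtain ⟨x, hx, hxJ⟩ := SetLike.not_le_iff_exists.1 h1
        obtain ⟨y, hy, hyJ⟩ := SetLike.not_le_iff_exists.1 h2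
        have key : |x| ⊓ |y| ∈ I ⊓ K :=
          ⟨hI.of_le (hI.abs_mem hx) (le_inf (abs_nonneg x) (abs_nonneg y)) inf_le_left,
            hK.of_le (hK.abs_mem hy) (le_inf (abs_nonneg x) (abs_nonneg y)) inf_le_right⟩
        rcases J.prime (abs_nonneg x) (abs_nonneg y) (h key) with h' | h'
        · exact hxJ (J.isRieszIdeal h' (by rw [abs_abs]))
        · exact hyJ (J.isRieszIdeal h' (by rw [abs_abs])))

theorem isClosed_spec_iff {X : Set (Spec A)} :
    IsClosed X ↔ ∃ I : Submodule ℝ A, IsRieszIdeal I ∧ X = hull I := by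
  rw [← isOpen_compl_iff]
  change Xᶜᶜ ∈ _ ↔ _
  rw [compl_compl]
  rfl

/-! #### The evaluation homomorphism of a maximal ideal -/

theorem Spec.unit_notMem (M : Spec A) {u : A} (hu : IsStrongUnit u) : u ∉ M.ideal := by
  intro h
  refine M.ne_top (eq_top_iff.2 fun a _ => ?_)
  obtain ⟨n, hn⟩ := hu.2 a
  refine M.isRieszIdeal (a := n • u) (M.ideal.smul_of_tower_mem n h) ?_
  exact hn.trans (le_abs_self _)

theorem Spec.value_unique (M : Spec A) {u : A} (hu : IsStrongUnit u) {a : A} {r s : ℝ}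
    (hr : r • u - a ∈ M.ideal) (hs : s • u - a ∈ M.ideal) : r = s := by
  by_contra h
  apply M.unit_notMem hu
  have h1 : (r - s) • u ∈ M.ideal := by
    have := M.ideal.sub_mem hr hs
    rwa [sub_sub_sub_cancel_right, ← sub_smul] at this
  have h2 := M.ideal.smul_mem (r - s)⁻¹ h1
  rwa [smul_smul, inv_mul_cancel₀ (sub_ne_zero.2 h), one_smul] at h2

theorem IsStrongUnit.exists_real {u : A} (hu : IsStrongUnit u) (a : A) :
    ∃ r : ℝ, 0 ≤ r ∧ |a| ≤ r • u := by
  obtain ⟨n, hn⟩ := hu.2 a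
  exact ⟨n, n.cast_nonneg, by rwa [Nat.cast_smul_eq_nsmul]⟩

theorem Spec.not_le (M : Spec A) {u : A} (hu : IsStrongUnit u) {r : ℝ} (hr : 0 < r) {j : A}
    (hj : j ∈ M.ideal) : ¬ r • u ≤ j := by
  intro h
  apply M.unit_notMem hu
  have h1 : r • u ∈ M.ideal := M.isRieszIdeal.of_le hj (smul_nonneg hr.le hu.1) h
  have h2 := M.ideal.smul_mem r⁻¹ h1
  rwa [smul_smul, inv_mul_cancel₀ hr.ne', one_smul] at h2

theorem Spec.exists_value (M : Spec A) {u : A} (hu : IsStrongUnit u) (a : A) :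
    ∃ r : ℝ, r • u - a ∈ M.ideal := by
  set S : Set ℝ := {r | (a - r • u)⁺ ∈ M.ideal} with hS
  obtain ⟨n, hn0, hn⟩ := hu.exists_real a
  have hne : n ∈ S := by
    have : (a - n • u)⁺ = 0 := posPart_eq_zero.2 (sub_nonpos.2 ((le_abs_self a).trans hn))
    rw [hS, Set.mem_ofPred_eq, this]; exact M.ideal.zero_mem
  have hbdd : BddBelow S := by
    refine ⟨-n - 1, fun r hr => ?_⟩
    by_contra! hlt
    refine M.not_le hu one_pos hr (le_trans ?_ (le_posPart _))
    have h1 : -(n • u) ≤ a := (neg_le_neg hn).trans (neg_le.1 (neg_le_abs a))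
    have h2 : (1 : ℝ) • u ≤ (-n - r) • u :=
      smul_le_smul_of_nonneg_right (by linarith) hu.1
    calc (1 : ℝ) • u ≤ (-n - r) • u := h2
      _ = -(n • u) - r • u := by rw [sub_smul, neg_smul]
      _ ≤ a - r • u := sub_le_sub_right h1 _
  set r0 := sInf S with hr0
  have hup : ∀ ε : ℝ, 0 < ε → (a - (r0 + ε) • u)⁺ ∈ M.ideal := by
    intro ε hε
    obtain ⟨r, hr, hlt⟩ := exists_lt_of_csInf_lt ⟨n, hne⟩ (show sInf S < r0 + ε by linarith)
    refine M.isRieszIdeal.of_le hr (posPart_nonneg _) (posPart_mono ?_)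
    exact sub_le_sub_left (smul_le_smul_of_nonneg_right hlt.le hu.1) _
  have hdn : ∀ ε : ℝ, 0 < ε → (a - (r0 - ε) • u)⁻ ∈ M.ideal := by
    intro ε hε
    have h1 : r0 - ε ∉ S := fun h => by
      have := csInf_le hbdd h
      linarith
    refine (M.prime (posPart_nonneg (a - (r0 - ε) • u)) (negPart_nonneg _) ?_).resolve_left h1
    rw [posPart_inf_negPart_eq_zero]; exact M.ideal.zero_mem
  refine ⟨r0, ?_⟩
  by_contra hc
  obtain ⟨j, hj, hj0, s, hs, h1⟩ := M.exists_le hc u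
  rw [abs_of_nonneg hu.1] at h1
  set ε : ℝ := (2 * (s + 1))⁻¹ with hεdef
  have hε : 0 < ε := by positivity
  have h2 : |r0 • u - a| ≤ ε • u + ((a - (r0 + ε) • u)⁺ + (a - (r0 - ε) • u)⁻) := by
    rw [abs_le']
    constructor
    · have h3 := neg_le_negPart (a - (r0 - ε) • u)
      calc r0 • u - a = ε • u + -(a - (r0 - ε) • u) := by rw [sub_smul]; abel
        _ ≤ ε • u + (a - (r0 - ε) • u)⁻ := add_le_add_right h3 _
        _ ≤ _ := add_le_add_right (le_add_of_nonneg_left (posPart_nonneg _)) _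
    · have h3 := le_posPart (a - (r0 + ε) • u)
      calc -(r0 • u - a) = ε • u + (a - (r0 + ε) • u) := by rw [add_smul]; abel
        _ ≤ ε • u + (a - (r0 + ε) • u)⁺ := add_le_add_right h3 _
        _ ≤ _ := add_le_add_right (le_add_of_nonneg_right (negPart_nonneg _)) _
  set k := (a - (r0 + ε) • u)⁺ + (a - (r0 - ε) • u)⁻ with hk
  have hkM : k ∈ M.ideal := M.ideal.add_mem (hup ε hε) (hdn ε hε)
  have h4 : u ≤ j + (s * ε) • u + s • k := by
    refine h1.trans ?_
    rw [mul_smul, add_assoc, ← smul_add]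
    exact add_le_add_right (smul_le_smul_of_nonneg_left h2 hs) _
  have h5 : s * ε ≤ 1 / 2 := by
    rw [hεdef, ← div_eq_mul_inv, div_le_iff₀ (by positivity)]
    linarith
  refine M.not_le hu (show (0 : ℝ) < 1 / 2 by norm_num)
    (M.ideal.add_mem hj (M.ideal.smul_mem s hkM)) ?_
  have h6 : (s * ε) • u ≤ (1 / 2 : ℝ) • u := smul_le_smul_of_nonneg_right h5 hu.1
  have h7 : u = (1 / 2 : ℝ) • u + (1 / 2 : ℝ) • u := by rw [← add_smul]; norm_num
  have h8 : u ≤ (j + s • k) + (1 / 2 : ℝ) • u := by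
    refine h4.trans ?_
    rw [add_right_comm]
    exact add_le_add_right h6 _
  have h9 : (1 / 2 : ℝ) • u + (1 / 2 : ℝ) • u ≤ (j + s • k) + (1 / 2 : ℝ) • u := by
    rwa [← h7]
  exact le_of_add_le_add_right h9

/-- For a strong unit `u`, the value at a maximal ideal `J` of (the function represented by) an
element `a`: the unique real number `r` such that `r u - a ∈ J`. -/
noncomputable def Spec.value {u : A} (hu : IsStrongUnit u) (J : Spec A) (a : A) : ℝ :=
  (J.exists_value hu a).choose

theorem Spec.value_spec {u : A} (hu : IsStrongUnit u) (J : Spec A) (a : A) :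
    J.value hu a • u - a ∈ J.ideal := (J.exists_value hu a).choose_spec

theorem Spec.value_eq {u : A} (hu : IsStrongUnit u) (J : Spec A) {a : A} {r : ℝ}
    (h : r • u - a ∈ J.ideal) : J.value hu a = r := J.value_unique hu (J.value_spec hu a) h

theorem Spec.value_eq_zero_iff {u : A} (hu : IsStrongUnit u) (J : Spec A) {a : A} :
    J.value hu a = 0 ↔ a ∈ J.ideal := by
  constructor
  · intro h
    have := J.value_spec hu a
    rw [h, zero_smul, zero_sub] at this
    exact (J.ideal.neg_mem_iff).1 this
  · intro h
    refine J.value_eq hu ?_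
    rw [zero_smul, zero_sub]
    exact J.ideal.neg_mem h

theorem Spec.value_add {u : A} (hu : IsStrongUnit u) (J : Spec A) (a b : A) :
    J.value hu (a + b) = J.value hu a + J.value hu b := by
  refine J.value_eq hu ?_
  rw [add_smul, add_sub_add_comm]
  exact J.ideal.add_mem (J.value_spec hu a) (J.value_spec hu b)

theorem Spec.value_smul {u : A} (hu : IsStrongUnit u) (J : Spec A) (r : ℝ) (a : A) :
    J.value hu (r • a) = r * J.value hu a := by
  refine J.value_eq hu ?_
  rw [mul_smul, ← smul_sub]
  exact J.ideal.smul_mem r (J.value_spec hu a)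

theorem Spec.value_unit {u : A} (hu : IsStrongUnit u) (J : Spec A) : J.value hu u = 1 := by
  refine J.value_eq hu ?_
  rw [one_smul, sub_self]
  exact J.ideal.zero_mem

/-- The evaluation at a maximal ideal, as a linear map. -/
noncomputable def Spec.eval {u : A} (hu : IsStrongUnit u) (J : Spec A) : A →ₗ[ℝ] ℝ where
  toFun := J.value hu
  map_add' := J.value_add hu
  map_smul' := J.value_smul hu

theorem Spec.eval_apply {u : A} (hu : IsStrongUnit u) (J : Spec A) (a : A) :
    J.eval hu a = J.value hu a := rfl

theorem Spec.value_nonneg {u : A} (hu : IsStrongUnit u) (J : Spec A) {a : A} (ha : 0 ≤ a) :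
    0 ≤ J.value hu a := by
  by_contra! h
  refine J.not_le hu (neg_pos.2 h) (J.ideal.neg_mem (J.value_spec hu a)) ?_
  rw [neg_smul, neg_sub, sub_eq_add_neg]
  exact le_add_of_nonneg_left ha

theorem Spec.value_mono {u : A} (hu : IsStrongUnit u) (J : Spec A) {a b : A} (h : a ≤ b) :
    J.value hu a ≤ J.value hu b := by
  have h1 := J.value_nonneg hu (sub_nonneg.2 h)
  rw [← J.eval_apply hu, map_sub] at h1
  exact sub_nonneg.1 h1

theorem Spec.value_abs {u : A} (hu : IsStrongUnit u) (J : Spec A) (a : A) :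
    J.value hu |a| = |J.value hu a| := by
  have h1 : a ⊔ -a - |a| = 0 := sub_self _
  apply le_antisymm
  · refine le_of_eq_of_le (J.value_eq hu (r := |J.value hu a|) ?_) le_rfl
    refine J.isRieszIdeal (J.value_spec hu a) ?_
    have h2 : |J.value hu a| • u = |J.value hu a • u| := by
      rcases le_total 0 (J.value hu a) with h | h
      · rw [abs_of_nonneg h, abs_of_nonneg (smul_nonneg h hu.1)]
      · rw [abs_of_nonpos h, ← abs_neg, ← neg_smul,
          abs_of_nonneg (smul_nonneg (neg_nonneg.2 h) hu.1)]
    rw [h2]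
    exact abs_abs_sub_abs_le _ _
  · rw [abs_le']
    refine ⟨J.value_mono hu (le_abs_self a), ?_⟩
    have := J.value_mono hu (neg_le_abs a)
    rwa [← J.eval_apply hu, map_neg] at this

theorem Spec.value_sup {u : A} (hu : IsStrongUnit u) (J : Spec A) (a b : A) :
    J.value hu (a ⊔ b) = J.value hu a ⊔ J.value hu b := by
  rw [sup_eq_half_smul_add_add_abs_sub' ℝ a b, J.value_smul, J.value_add, J.value_add,
    J.value_abs, ← J.eval_apply hu (b - a), map_sub]
  rw [sup_eq_half_smul_add_add_abs_sub' ℝ (J.value hu a) (J.value hu b)]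
  rfl

theorem Spec.value_inf {u : A} (hu : IsStrongUnit u) (J : Spec A) (a b : A) :
    J.value hu (a ⊓ b) = J.value hu a ⊓ J.value hu b := by
  rw [inf_eq_half_smul_add_sub_abs_sub' ℝ a b, J.value_smul, ← J.eval_apply hu, map_sub,
    map_add, J.eval_apply, J.eval_apply, J.eval_apply,
    J.value_abs, ← J.eval_apply hu (b - a), map_sub]
  rw [inf_eq_half_smul_add_sub_abs_sub' ℝ (J.value hu a) (J.value hu b)]
  rfl

/-- The kernel of a unital Riesz homomorphism to the reals is a maximal ideal. -/
def Spec.ofHom {u : A} (φ : A →ₗ[ℝ] ℝ) (h1 : φ u = 1) (hφ : ∀ a, φ |a| = |φ a|) : Spec A where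
  ideal := LinearMap.ker φ
  isRieszIdeal := by
    intro a b ha hb
    rw [LinearMap.mem_ker] at ha ⊢
    have h2 : 0 ≤ φ (|(|a| - |b|)|) := by rw [hφ]; exact abs_nonneg _
    rw [abs_of_nonneg (sub_nonneg.2 hb), map_sub, hφ, hφ, ha, abs_zero, zero_sub] at h2
    exact abs_eq_zero.1 (le_antisymm (by linarith) (abs_nonneg _))
  ne_top h := by
    have : u ∈ LinearMap.ker φ := h ▸ trivial
    rw [LinearMap.mem_ker, h1] at this
    exact one_ne_zero this
  maximal K hK hne hle := by
    refine le_antisymm (fun b hb => ?_) hle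
    by_contra hc
    rw [LinearMap.mem_ker] at hc
    refine hne (eq_top_iff.2 fun a _ => ?_)
    have h3 : a - (φ a / φ b) • b ∈ K := hle (by
      rw [LinearMap.mem_ker, map_sub, map_smul, smul_eq_mul, div_mul_cancel₀ _ hc, sub_self])
    have := K.add_mem h3 (K.smul_mem (φ a / φ b) hb)
    rwa [sub_add_cancel] at this

theorem isRieszIdeal_bot : IsRieszIdeal (⊥ : Submodule ℝ A) := by
  intro a b ha hb
  rw [Submodule.mem_bot] at ha ⊢
  rw [ha, abs_zero] at hb
  have h1 : b ≤ 0 := (le_abs_self b).trans hb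
  have h2 : -b ≤ 0 := (neg_le_abs b).trans hb
  exact le_antisymm h1 (neg_nonpos.1 h2)

theorem IsRieszIdeal.eq_top {u : A} (hu : IsStrongUnit u) {K : Submodule ℝ A}
    (hK : IsRieszIdeal K) (h : u ∈ K) : K = ⊤ := by
  refine eq_top_iff.2 fun a _ => ?_
  obtain ⟨n, hn⟩ := hu.2 a
  exact hK (a := n • u) (K.smul_of_tower_mem n h) (hn.trans (le_abs_self _))

/-- Every proper ideal is contained in a maximal one. -/
theorem exists_spec_ge {u : A} (hu : IsStrongUnit u) {I : Submodule ℝ A} (hI : IsRieszIdeal I)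
    (hne : I ≠ ⊤) : ∃ J : Spec A, I ≤ J.ideal := by
  obtain ⟨M, hIM, hM⟩ := zorn_le_nonempty₀ {K : Submodule ℝ A | IsRieszIdeal K ∧ u ∉ K}
    (by
      intro c hc hchain K hKc
      refine ⟨sSup c, ⟨?_, ?_⟩, fun K hK => le_sSup hK⟩
      · intro a b ha hb
        rw [Submodule.mem_sSup_of_directed ⟨K, hKc⟩ hchain.directedOn] at ha ⊢
        obtain ⟨L, hL, haL⟩ := ha
        exact ⟨L, hL, (hc hL).1 haL hb⟩
      · rw [Submodule.mem_sSup_of_directed ⟨K, hKc⟩ hchain.directedOn]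
        rintro ⟨L, hL, haL⟩
        exact (hc hL).2 haL) I ⟨hI, fun h => hne (hI.eq_top hu h)⟩
  refine ⟨⟨M, hM.prop.1, fun h => hM.prop.2 (h ▸ trivial), fun K hK hKne hMK => ?_⟩, hIM⟩
  exact (hM.eq_of_le ⟨hK, fun h => hKne (hK.eq_top hu h)⟩ hMK).symm

theorem Spec.isClosed_value_le {u : A} (hu : IsStrongUnit u) (a : A) (c : ℝ) :
    IsClosed {J : Spec A | J.value hu a ≤ c} := by
  rw [isClosed_spec_iff]
  refine ⟨adjoin ⊥ isRieszIdeal_bot ((a - c • u) ⊔ 0), isRieszIdeal_adjoin _ _ _, ?_⟩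
  have key : ∀ J : Spec A, J.value hu a ≤ c ↔ (a - c • u) ⊔ 0 ∈ J.ideal := by
    intro J
    rw [← J.value_eq_zero_iff hu, J.value_sup, J.value_eq_zero_iff hu |>.2 J.ideal.zero_mem,
      ← J.eval_apply hu (a - _), map_sub, map_smul, J.eval_apply, J.eval_apply, J.value_unit,
      smul_eq_mul, mul_one, sup_eq_right, sub_nonpos]
  ext J
  rw [Set.mem_ofPred_eq, key]
  constructor
  · rintro h b ⟨j, hj, r, hr, hb⟩
    rw [Submodule.mem_bot] at hj
    rw [hj, abs_zero, zero_add] at hb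
    refine J.isRieszIdeal (a := r • |(a - c • u) ⊔ 0|)
      (J.ideal.smul_mem r (J.isRieszIdeal.abs_mem h)) (hb.trans (le_abs_self _))
  · intro h
    exact h (self_mem_adjoin _ _ _)

theorem Spec.continuous_value {u : A} (hu : IsStrongUnit u) (a : A) :
    Continuous fun J : Spec A => J.value hu a := by
  rw [continuous_iff_lower_upperSemicontinuous]
  constructor
  · rw [lowerSemicontinuous_iff_isClosed_preimage]
    exact fun c => Spec.isClosed_value_le hu a c
  · rw [upperSemicontinuous_iff_isClosed_preimage]
    intro c
    have := Spec.isClosed_value_le hu (-a) (-c)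
    convert this using 1
    ext J
    rw [Set.mem_ofPred_eq, ← J.eval_apply hu (-a), map_neg, neg_le_neg_iff]
    rfl

theorem Spec.t2Space {u : A} (hu : IsStrongUnit u) : T2Space (Spec A) := by
  refine T2Space.of_injective_continuous (f := fun (J : Spec A) (a : A) => J.value hu a) ?_
    (continuous_pi fun a => Spec.continuous_value hu a)
  intro J K h
  ext a
  rw [← J.value_eq_zero_iff hu, ← K.value_eq_zero_iff hu]
  exact iff_of_eq (congrArg (· = 0) (congrFun h a))

theorem Spec.compactSpace {u : A} (hu : IsStrongUnit u) : CompactSpace (Spec A) := by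
  rw [← isCompact_univ_iff, isCompact_iff_ultrafilter_le_nhds]
  intro U _
  have hlim : ∀ a : A, ∃ x : ℝ, Filter.Tendsto (fun J : Spec A => J.value hu a) U (nhds x) := by
    intro a
    obtain ⟨n, hn0, hn⟩ := hu.exists_real a
    have hn' : ∀ J : Spec A, J.value hu a ∈ Set.Icc (-n) n := by
      intro J
      have h1 := J.value_mono hu hn
      rw [J.value_abs, J.value_smul, J.value_unit, mul_one] at h1
      exact abs_le.1 h1
    obtain ⟨x, -, hx⟩ := (isCompact_Icc (a := -n) (b := n)).ultrafilter_le_nhds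
      (U.map fun J : Spec A => J.value hu a) (by
        rw [Filter.le_principal_iff]
        exact Filter.mem_map.2 (Filter.univ_mem' hn'))
    exact ⟨x, hx⟩
  choose φ hφ using hlim
  let Φ : A →ₗ[ℝ] ℝ :=
    { toFun := φ
      map_add' := fun a b => by
        refine tendsto_nhds_unique (hφ (a + b)) ?_
        simp_rw [Spec.value_add]
        exact (hφ a).add (hφ b)
      map_smul' := fun r a => by
        refine tendsto_nhds_unique (hφ (r • a)) ?_
        simp_rw [Spec.value_smul]
        exact (hφ a).const_mul r }
  have hΦ : ∀ a, Φ |a| = |Φ a| := fun a => by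
    refine tendsto_nhds_unique (hφ |a|) ?_
    simp_rw [Spec.value_abs]
    exact (hφ a).abs
  have hu1 : Φ u = 1 := by
    refine tendsto_nhds_unique (hφ u) ?_
    simp_rw [Spec.value_unit]
    exact tendsto_const_nhds
  refine ⟨Spec.ofHom Φ hu1 hΦ, trivial, ?_⟩
  rw [le_nhds_iff]
  intro s hs hso
  by_contra hc
  obtain ⟨I, hI, hIs⟩ := isClosed_spec_iff.1 hso.isClosed_compl
  have h1 : sᶜ ∈ U := Ultrafilter.compl_mem_iff_notMem.2 hc
  have h2 : Spec.ofHom Φ hu1 hΦ ∈ sᶜ := by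
    rw [hIs]
    intro a ha
    change φ a = 0
    refine tendsto_nhds_unique (hφ a) (tendsto_const_nhds.congr' ?_)
    filter_upwards [h1] with J hJ
    rw [hIs] at hJ
    exact ((J.value_eq_zero_iff hu).2 (hJ ha)).symm
  exact h2 hs

/-- The continuous function `â` on the spectrum represented by an element `a`. -/
noncomputable def hat {u : A} (hu : IsStrongUnit u) (a : A) : C(Spec A, ℝ) where
  toFun J := J.value hu a
  continuous_toFun := Spec.continuous_value hu a

/-- `a ↦ â` as a linear map. -/
noncomputable def hatLin {u : A} (hu : IsStrongUnit u) : A →ₗ[ℝ] C(Spec A, ℝ) where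
  toFun := hat hu
  map_add' a b := by ext J; exact J.value_add hu a b
  map_smul' r a := by ext J; exact J.value_smul hu r a

theorem hat_nonneg {u : A} (hu : IsStrongUnit u) {a : A} (h : 0 ≤ hat hu a) {ε : ℝ}
    (hε : 0 < ε) : 0 ≤ a + ε • u := by
  set d := a + ε • u with hd
  have h1 : adjoin ⊥ isRieszIdeal_bot d⁺ = ⊤ := by
    by_contra hne
    obtain ⟨J, hJ⟩ := exists_spec_ge hu (isRieszIdeal_adjoin _ _ _) hne
    have h2 : d⁺ ∈ J.ideal := hJ (self_mem_adjoin _ _ _)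
    have h3 : J.value hu d ≤ 0 := by
      rw [← (J.value_eq_zero_iff hu).2 h2]
      exact J.value_mono hu (le_posPart d)
    rw [hd, J.value_add, J.value_smul, J.value_unit, mul_one] at h3
    have h4 : 0 ≤ J.value hu a := h J
    linarith
  have h2 : u ∈ adjoin ⊥ isRieszIdeal_bot d⁺ := h1 ▸ trivial
  obtain ⟨j, hj, r, hr, h3⟩ := h2
  rw [Submodule.mem_bot] at hj
  rw [hj, abs_zero, zero_add, abs_of_nonneg hu.1, abs_of_nonneg (posPart_nonneg d)] at h3
  obtain ⟨s, hs, h4⟩ := hu.exists_real d⁻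
  rw [abs_of_nonneg (negPart_nonneg d)] at h4
  rw [← negPart_eq_zero]
  refine le_antisymm ?_ (negPart_nonneg d)
  calc d⁻ = d⁻ ⊓ ((s * r) • d⁺) := by
        refine (inf_eq_left.2 (h4.trans ?_)).symm
        rw [mul_smul]
        exact smul_le_smul_of_nonneg_left h3 hs
    _ ≤ (s * r + 1) • (d⁻ ⊓ d⁺) :=
        inf_smul_le (negPart_nonneg d) (posPart_nonneg d) (mul_nonneg hs hr)
    _ = 0 := by rw [inf_comm, posPart_inf_negPart_eq_zero, smul_zero]

/-- The functions `â` are dense in the space of continuous functions on the spectrum. -/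
theorem exists_hat_close {u : A} (hu : IsStrongUnit u) (g : C(Spec A, ℝ)) {ε : ℝ} (hε : 0 < ε) :
    ∃ a : A, ∀ J, |g J - hat hu a J| < ε := by
  have := Spec.compactSpace hu
  have h1 : closure (Set.range (hat hu)) = ⊤ := by
    refine ContinuousMap.sublattice_closure_eq_top _ ⟨_, 0, rfl⟩ ?_ ?_ ?_
    · rintro _ ⟨a, rfl⟩ _ ⟨b, rfl⟩
      exact ⟨a ⊓ b, by ext J; exact J.value_inf hu a b⟩
    · rintro _ ⟨a, rfl⟩ _ ⟨b, rfl⟩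
      exact ⟨a ⊔ b, by ext J; exact J.value_sup hu a b⟩
    · intro v J K
      by_cases hJK : J = K
      · subst hJK
        refine ⟨_, ⟨v J • u, rfl⟩, ?_, ?_⟩ <;>
        · change J.value hu (v J • u) = _
          rw [J.value_smul, J.value_unit, mul_one]
      · have h2 : ¬ J.ideal ≤ K.ideal := fun hle =>
          hJK (Spec.ext (J.maximal _ K.isRieszIdeal K.ne_top hle).symm)
        obtain ⟨x, hxJ, hxK⟩ := SetLike.not_le_iff_exists.1 h2
        have h3 : J.value hu x = 0 := (J.value_eq_zero_iff hu).2 hxJ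
        have h4 : K.value hu x ≠ 0 := fun h => hxK ((K.value_eq_zero_iff hu).1 h)
        refine ⟨_, ⟨v J • u + ((v K - v J) / K.value hu x) • x, rfl⟩, ?_, ?_⟩
        · change J.value hu _ = _
          rw [J.value_add, J.value_smul, J.value_smul, J.value_unit, h3]
          ring
        · change K.value hu _ = _
          rw [K.value_add, K.value_smul, K.value_smul, K.value_unit, div_mul_cancel₀ _ h4]
          ring
  have h2 : g ∈ closure (Set.range (hat hu)) := h1 ▸ trivial
  obtain ⟨_, ⟨a, rfl⟩, ha⟩ := Metric.mem_closure_iff.1 h2 ε hε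
  refine ⟨a, fun J => lt_of_le_of_lt ?_ ha⟩
  rw [← Real.dist_eq]
  exact ContinuousMap.dist_apply_le_dist J

end Riesz

/-! ### The Radon functor and Markov processes -/

section Radon

attribute [local instance] borel

/-- A Radon subprobability measure on a topological space `X`: a Borel measure of total mass at
most `1` such that the measure of every Borel set is the supremum of the measures of its compact
subsets. -/
@[ext]
structure RadonSub (X : Type u) [TopologicalSpace X] where
  toMeasure : @Measure X (borel X)
  measure_univ_le : toMeasure Set.univ ≤ 1
  innerRegular : ∀ s : Set X, MeasurableSet[borel X] s →
    toMeasure s = ⨆ (K : Set X) (_ : K ⊆ s) (_ : IsCompact K), toMeasure K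

theorem borelSpace_borel (X : Type u) [TopologicalSpace X] : @BorelSpace X _ (borel X) :=
  @BorelSpace.mk X _ (borel X) rfl

attribute [local instance] borelSpace_borel

variable {X Y : Type u} [TopologicalSpace X] [TopologicalSpace Y]

/-- The expectation `∫ f dμ` of a continuous function. -/
noncomputable def RadonSub.expect (μ : RadonSub X) (f : C(X, ℝ)) : ℝ := ∫ x, f x ∂μ.toMeasure

/-- The weak-* topology: the coarsest one for which all maps `μ ↦ ∫ f dμ` are continuous. -/
noncomputable instance : TopologicalSpace (RadonSub X) :=
  TopologicalSpace.induced (fun (μ : RadonSub X) (f : C(X, ℝ)) => μ.expect f) inferInstance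

theorem RadonSub.isFiniteMeasure (μ : RadonSub X) : IsFiniteMeasure μ.toMeasure :=
  ⟨lt_of_le_of_lt μ.measure_univ_le ENNReal.one_lt_top⟩

attribute [local instance] RadonSub.isFiniteMeasure

theorem RadonSub.isInnerRegular (μ : RadonSub X) : μ.toMeasure.InnerRegular := by
  refine ⟨fun s hs r hr => ?_⟩
  rw [μ.innerRegular s hs] at hr
  simp only [lt_iSup_iff] at hr
  obtain ⟨K, hK, hKc, h⟩ := hr
  exact ⟨K, hK, hKc, h⟩

/-- The pushforward of a Radon subprobability measure along a continuous map. -/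
noncomputable def RadonSub.map (f : C(X, Y)) (μ : RadonSub X) : RadonSub Y where
  toMeasure := μ.toMeasure.map f
  measure_univ_le := by
    rw [Measure.map_apply f.continuous.measurable MeasurableSet.univ]
    exact μ.measure_univ_le
  innerRegular := by
    intro s hs
    have := μ.isInnerRegular
    have h : (μ.toMeasure.map f).InnerRegular :=
      Measure.InnerRegular.map_of_continuous f.continuous
    exact hs.measure_eq_iSup_isCompact _

theorem RadonSub.expect_map (f : C(X, Y)) (μ : RadonSub X) (g : C(Y, ℝ)) :
    (μ.map f).expect g = μ.expect (g.comp f) := by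
  unfold RadonSub.expect RadonSub.map
  rw [integral_map f.continuous.measurable.aemeasurable
    g.continuous.measurable.aestronglyMeasurable]
  rfl

theorem RadonSub.continuous_expect (f : C(X, ℝ)) : Continuous fun μ : RadonSub X => μ.expect f :=
  continuous_pi_iff.1
    (continuous_induced_dom (f := fun (μ : RadonSub X) (f : C(X, ℝ)) => μ.expect f)) f

theorem RadonSub.continuous_iff {Z : Type*} [TopologicalSpace Z] {F : Z → RadonSub X} :
    Continuous F ↔ ∀ f : C(X, ℝ), Continuous fun z => (F z).expect f := by
  rw [continuous_induced_rng, continuous_pi_iff]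
  rfl

theorem RadonSub.continuous_map (f : C(X, Y)) : Continuous (RadonSub.map f) := by
  rw [RadonSub.continuous_iff]
  intro g
  simp_rw [RadonSub.expect_map]
  exact RadonSub.continuous_expect _

variable [CompactSpace X] [T2Space X] [CompactSpace Y] [T2Space Y]

theorem RadonSub.integrable (μ : RadonSub X) (f : C(X, ℝ)) : Integrable (fun x => f x) μ.toMeasure :=
  f.continuous.integrable_of_hasCompactSupport (HasCompactSupport.of_compactSpace _)

theorem RadonSub.expect_add (μ : RadonSub X) (f g : C(X, ℝ)) :
    μ.expect (f + g) = μ.expect f + μ.expect g :=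
  integral_add (μ.integrable f) (μ.integrable g)

theorem RadonSub.expect_smul (μ : RadonSub X) (r : ℝ) (f : C(X, ℝ)) :
    μ.expect (r • f) = r * μ.expect f :=
  integral_const_mul r _

theorem RadonSub.expect_nonneg (μ : RadonSub X) {f : C(X, ℝ)} (hf : 0 ≤ f) : 0 ≤ μ.expect f :=
  integral_nonneg fun x => hf x

theorem RadonSub.expect_one (μ : RadonSub X) : μ.expect 1 ≤ 1 := by
  have : μ.expect 1 = (μ.toMeasure Set.univ).toReal := by
    unfold RadonSub.expect
    simp [Measure.real]
  rw [this]
  exact ENNReal.toReal_le_of_le_ofReal zero_le_one (by simpa using μ.measure_univ_le)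

theorem RadonSub.ext_expect {μ ν : RadonSub X} (h : ∀ f, μ.expect f = ν.expect f) : μ = ν := by
  have := μ.isInnerRegular
  have := ν.isInnerRegular
  apply RadonSub.ext
  refine Measure.ext_of_integral_eq_on_compactlySupported fun f => ?_
  exact h f.toContinuousMap

/-- Every positive, linear and `1`-decreasing functional is integration against a Radon
subprobability measure. -/
theorem RadonSub.exists_of_functional (F : C(X, ℝ) →ₗ[ℝ] ℝ) (hpos : ∀ f, 0 ≤ f → 0 ≤ F f)
    (hone : F 1 ≤ 1) : ∃ μ : RadonSub X, ∀ f, μ.expect f = F f := by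
  let Λ : CompactlySupportedContinuousMap X ℝ →ₚ[ℝ] ℝ :=
    { toFun := fun f => F f.toContinuousMap
      map_add' := fun f g => F.map_add _ _
      map_smul' := fun r f => F.map_smul r _
      monotone' := fun f g h => by
        rw [← sub_nonneg]
        have := hpos (g.toContinuousMap - f.toContinuousMap) (fun x => sub_nonneg.2 (h x))
        rwa [map_sub] at this }
  refine ⟨⟨RealRMK.rieszMeasure Λ, ?_, ?_⟩, ?_⟩
  · let o : CompactlySupportedContinuousMap X ℝ := ⟨1, HasCompactSupport.of_compactSpace 1⟩
    refine (RealRMK.rieszMeasure_le_of_eq_one Λ (f := o) (fun x => zero_le_one) isCompact_univ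
      (fun x hx => rfl)).trans ?_
    exact ENNReal.ofReal_le_one.2 hone
  · intro s hs
    exact hs.measure_eq_iSup_isCompact _
  · intro f
    exact RealRMK.integral_rieszMeasure Λ ⟨f, HasCompactSupport.of_compactSpace _⟩

theorem RadonSub.t2Space : T2Space (RadonSub X) := by
  refine T2Space.of_injective_continuous (f := fun (μ : RadonSub X) (f : C(X, ℝ)) => μ.expect f)
    ?_ continuous_induced_dom
  intro μ ν h
  exact RadonSub.ext_expect fun f => congrFun h f

theorem RadonSub.abs_expect_le (μ : RadonSub X) (f : C(X, ℝ)) {c : ℝ} (hc : 0 ≤ c)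
    (h : ∀ x, |f x| ≤ c) : |μ.expect f| ≤ c := by
  have key : ∀ g : C(X, ℝ), (∀ x, g x ≤ c) → μ.expect g ≤ c := by
    intro g hg
    have h1 := μ.expect_nonneg (f := c • (1 : C(X, ℝ)) + (-1 : ℝ) • g) (by
      intro x
      have := hg x
      simp
      linarith)
    rw [μ.expect_add, μ.expect_smul, μ.expect_smul] at h1
    have h2 := mul_le_mul_of_nonneg_left μ.expect_one hc
    linarith
  rw [abs_le']
  refine ⟨key f fun x => (le_abs_self _).trans (h x), ?_⟩
  have h3 := key ((-1 : ℝ) • f) fun x => by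
    have := (neg_le_abs (f x)).trans (h x)
    simpa using this
  rw [μ.expect_smul] at h3
  linarith

theorem RadonSub.compactSpace : CompactSpace (RadonSub X) := by
  have hind : Topology.IsInducing (fun (μ : RadonSub X) (f : C(X, ℝ)) => μ.expect f) := ⟨rfl⟩
  have hrange : Set.range (fun (μ : RadonSub X) (f : C(X, ℝ)) => μ.expect f) =
      {F : C(X, ℝ) → ℝ | (∀ f g, F (f + g) = F f + F g) ∧ (∀ (r : ℝ) f, F (r • f) = r * F f) ∧
        (∀ f, 0 ≤ f → 0 ≤ F f) ∧ F 1 ≤ 1} := by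
    ext F
    constructor
    · rintro ⟨μ, rfl⟩
      exact ⟨μ.expect_add, μ.expect_smul, fun f hf => μ.expect_nonneg hf, μ.expect_one⟩
    · rintro ⟨h1, h2, h3, h4⟩
      obtain ⟨μ, hμ⟩ := RadonSub.exists_of_functional
        { toFun := F, map_add' := h1, map_smul' := h2 } h3 h4
      exact ⟨μ, funext hμ⟩
  have hclosed : IsClosed (Set.range (fun (μ : RadonSub X) (f : C(X, ℝ)) => μ.expect f)) := by
    rw [hrange]
    simp only [Set.ofPred_and, Set.ofPred_forall]
    refine IsClosed.inter ?_ (IsClosed.inter ?_ (IsClosed.inter ?_ ?_))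
    · exact isClosed_iInter fun f => isClosed_iInter fun g =>
        isClosed_eq (continuous_apply _) (by fun_prop)
    · exact isClosed_iInter fun r => isClosed_iInter fun f =>
        isClosed_eq (continuous_apply _) (by fun_prop)
    · exact isClosed_iInter fun f => isClosed_iInter fun _ =>
        isClosed_le continuous_const (continuous_apply _)
    · exact isClosed_le (continuous_apply _) continuous_const
  have hcpt : IsCompact (Set.range (fun (μ : RadonSub X) (f : C(X, ℝ)) => μ.expect f)) := by
    refine (isCompact_univ_pi fun f : C(X, ℝ) =>
      isCompact_Icc (a := -‖f‖) (b := ‖f‖)).of_isClosed_subset hclosed ?_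
    rintro _ ⟨μ, rfl⟩ f -
    exact abs_le.1 (μ.abs_expect_le f (norm_nonneg f) fun x => f.norm_coe_le_norm x)
  exact ⟨hind.isCompact_iff.2 (by rwa [Set.image_univ])⟩

attribute [local instance] RadonSub.t2Space RadonSub.compactSpace

theorem RadonSub.map_id : RadonSub.map (ContinuousMap.id X) = id := by
  funext μ
  refine RadonSub.ext_expect fun f => ?_
  rw [RadonSub.expect_map]
  rfl

theorem RadonSub.map_comp {Z : Type u} [TopologicalSpace Z] [CompactSpace Z] [T2Space Z]
    (f : C(X, Y)) (g : C(Y, Z)) (μ : RadonSub X) : μ.map (g.comp f) = (μ.map f).map g := by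
  refine RadonSub.ext_expect fun h => ?_
  rw [RadonSub.expect_map, RadonSub.expect_map, RadonSub.expect_map]
  rfl

/-- The endofunctor of compact Hausdorff spaces that sends `X` to the space of Radon
subprobability measures on `X` with the weak-* topology, and a map to the pushforward. -/
noncomputable def radonFunctor : CompHaus.{u} ⥤ CompHaus.{u} where
  obj X := CompHaus.of (RadonSub X)
  map {X Y} f := CompHausLike.ofHom _
    ⟨RadonSub.map (ConcreteCategory.hom f), RadonSub.continuous_map _⟩
  map_id X := by
    refine ConcreteCategory.hom_ext _ _ fun μ => ?_
    exact congrFun RadonSub.map_id μ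
  map_comp {X Y Z} f g := by
    refine ConcreteCategory.hom_ext _ _ fun μ => ?_
    exact RadonSub.map_comp _ _ μ

/-- The category of Markov processes: coalgebras of the Radon functor, i.e. continuous maps from
a compact Hausdorff space `X` to the space of Radon subprobability measures on `X`, with coalgebra
morphisms. -/
abbrev Markov : Type (u + 1) := Endofunctor.Coalgebra radonFunctor.{u}

/-- The Radon subprobability measure of the state `x`. -/
noncomputable def transition (M : Markov.{u}) (x : M.V) : RadonSub M.V :=
  (ConcreteCategory.hom M.str : C(M.V, RadonSub M.V)) x

theorem continuous_transition (M : Markov.{u}) : Continuous (transition M) :=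
  (ConcreteCategory.hom M.str : C(M.V, RadonSub M.V)).continuous

end Radon

/-! ### Modal Riesz spaces -/

/-- A modal Riesz space `(A, u, ◇)`: a Riesz space with a distinguished positive element `u` and a
linear, positive, `u`-decreasing operation `◇`. -/
structure ModalRiesz : Type (u + 1) where
  carrier : Type u
  [addCommGroup : AddCommGroup carrier]
  [lattice : Lattice carrier]
  [isOrderedAddMonoid : IsOrderedAddMonoid carrier]
  [module : Module ℝ carrier]
  [isOrderedModule : IsOrderedModule ℝ carrier]
  unit : carrier
  unit_nonneg : 0 ≤ unit
  dia : carrier →ₗ[ℝ] carrier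
  dia_nonneg : ∀ a, 0 ≤ dia (a ⊔ 0)
  dia_unit_le : dia unit ≤ unit

namespace ModalRiesz

instance : CoeSort ModalRiesz.{u} (Type u) := ⟨carrier⟩

attribute [instance] addCommGroup lattice isOrderedAddMonoid module isOrderedModule

/-- Homomorphisms of modal Riesz spaces: linear maps that preserve the lattice operations, the
distinguished element and the modality. -/
@[ext]
structure Hom (A B : ModalRiesz.{u}) where
  toLin : A →ₗ[ℝ] B
  map_sup : ∀ a b, toLin (a ⊔ b) = toLin a ⊔ toLin b
  map_inf : ∀ a b, toLin (a ⊓ b) = toLin a ⊓ toLin b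
  map_unit : toLin A.unit = B.unit
  map_dia : ∀ a, toLin (A.dia a) = B.dia (toLin a)

instance : Category ModalRiesz.{u} where
  Hom := Hom
  id A := ⟨LinearMap.id, fun _ _ => rfl, fun _ _ => rfl, rfl, fun _ => rfl⟩
  comp f g := ⟨g.toLin.comp f.toLin,
    fun a b => by simp [f.map_sup, g.map_sup], fun a b => by simp [f.map_inf, g.map_inf],
    by simp [f.map_unit, g.map_unit], fun a => by simp [f.map_dia, g.map_dia]⟩

/-- Archimedean unital modal Riesz spaces. -/
def isAU : ObjectProperty ModalRiesz.{u} := fun A =>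
  IsArchimedeanRiesz A ∧ IsStrongUnit A.unit

/-- Archimedean, unital and uniformly complete modal Riesz spaces. -/
def isCAU : ObjectProperty ModalRiesz.{u} := fun A =>
  IsArchimedeanRiesz A ∧ IsStrongUnit A.unit ∧ IsUnifComplete A.unit

theorem dia_mono (A : ModalRiesz.{u}) {a b : A} (h : a ≤ b) : A.dia a ≤ A.dia b := by
  have := A.dia_nonneg (b - a)
  rwa [sup_eq_left.2 (sub_nonneg.2 h), map_sub, sub_nonneg] at this

theorem abs_dia_le (A : ModalRiesz.{u}) (a : A) : |A.dia a| ≤ A.dia |a| := by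
  rw [abs_le']
  refine ⟨A.dia_mono (le_abs_self a), ?_⟩
  rw [← map_neg]
  exact A.dia_mono (neg_le_abs a)

end ModalRiesz

/-- The category of Archimedean unital modal Riesz spaces. -/
abbrev AURieszDia : Type (u + 1) := ModalRiesz.isAU.{u}.FullSubcategory

/-- The category of Archimedean, unital and uniformly complete modal Riesz spaces. -/
abbrev CAURieszDia : Type (u + 1) := ModalRiesz.isCAU.{u}.FullSubcategory

/-! ### The initial algebra: formulas modulo provable equality -/

/-- Formulas of Riesz modal logic: closed terms in the signature of modal Riesz spaces. -/
inductive Form : Type u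
  | zero : Form
  | one : Form
  | add : Form → Form → Form
  | smul : ℝ → Form → Form
  | sup : Form → Form → Form
  | inf : Form → Form → Form
  | dia : Form → Form

/-- Provable equality of formulas, in equational logic, from the axioms of modal Riesz spaces
(for closed terms it is enough to use closed instances of the axioms). An inequality `φ ≤ ψ` in an
axiom stands for the equality `φ ⊓ ψ = φ`. -/
inductive Provable : Form.{u} → Form.{u} → Prop
  | refl (x) : Provable x x
  | symm {x y} : Provable x y → Provable y x
  | trans {x y z} : Provable x y → Provable y z → Provable x z
  | congr_add {x x' y y'} : Provable x x' → Provable y y' → Provable (.add x y) (.add x' y')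
  | congr_smul (r) {x x'} : Provable x x' → Provable (.smul r x) (.smul r x')
  | congr_sup {x x' y y'} : Provable x x' → Provable y y' → Provable (.sup x y) (.sup x' y')
  | congr_inf {x x' y y'} : Provable x x' → Provable y y' → Provable (.inf x y) (.inf x' y')
  | congr_dia {x x'} : Provable x x' → Provable (.dia x) (.dia x')
  | add_assoc (x y z) : Provable (.add x (.add y z)) (.add (.add x y) z)
  | add_comm (x y) : Provable (.add x y) (.add y x)
  | add_zero (x) : Provable (.add x .zero) x
  | add_neg (x) : Provable (.add x (.smul (-1) x)) .zero
  | smul_smul (r s x) : Provable (.smul r (.smul s x)) (.smul (r * s) x)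
  | one_smul (x) : Provable (.smul 1 x) x
  | smul_add (r x y) : Provable (.smul r (.add x y)) (.add (.smul r x) (.smul r y))
  | add_smul (r s x) : Provable (.smul (r + s) x) (.add (.smul r x) (.smul s x))
  | sup_assoc (x y z) : Provable (.sup x (.sup y z)) (.sup (.sup x y) z)
  | inf_assoc (x y z) : Provable (.inf x (.inf y z)) (.inf (.inf x y) z)
  | sup_comm (x y) : Provable (.sup x y) (.sup y x)
  | inf_comm (x y) : Provable (.inf x y) (.inf y x)
  | sup_inf_self (x y) : Provable (.sup x (.inf x y)) x
  | inf_sup_self (x y) : Provable (.inf x (.sup x y)) x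
  | sup_idem (x) : Provable (.sup x x) x
  | inf_idem (x) : Provable (.inf x x) x
  | add_le (x y z) :
      Provable (.inf (.add (.inf x y) z) (.add y z)) (.add (.inf x y) z)
  | smul_le (r : ℝ) (hr : 0 ≤ r) (x y) :
      Provable (.inf (.smul r (.inf x y)) (.smul r y)) (.smul r (.inf x y))
  | zero_le_one : Provable (.inf .zero .one) .zero
  | dia_linear (r s x y) : Provable (.dia (.add (.smul r x) (.smul s y)))
      (.add (.smul r (.dia x)) (.smul s (.dia y)))
  | zero_le_dia (x) : Provable (.inf .zero (.dia (.sup x .zero))) .zero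
  | dia_one_le : Provable (.inf (.dia .one) .one) (.dia .one)

/-- The setoid of provable equality. -/
def formSetoid : Setoid Form.{u} :=
  ⟨Provable, Provable.refl, Provable.symm, Provable.trans⟩

/-- Formulas modulo provable equality. -/
def FormQuot : Type u := Quotient formSetoid.{u}

namespace FormQuot

/-- The class of a formula. -/
def mk (x : Form.{u}) : FormQuot.{u} := Quotient.mk formSetoid x

theorem sound {x y : Form.{u}} (h : Provable x y) : mk x = mk y := Quotient.sound h

theorem ind {p : FormQuot.{u} → Prop} (h : ∀ x, p (mk x)) (a : FormQuot.{u}) : p a :=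
  Quotient.ind h a

instance : Zero FormQuot.{u} := ⟨mk .zero⟩
instance : One FormQuot.{u} := ⟨mk .one⟩
instance : Add FormQuot.{u} := ⟨Quotient.map₂ .add fun _ _ h _ _ h' => .congr_add h h'⟩
instance : SMul ℝ FormQuot.{u} := ⟨fun r => Quotient.map (.smul r) fun _ _ h => .congr_smul r h⟩
instance : Neg FormQuot.{u} := ⟨fun a => (-1 : ℝ) • a⟩
instance : Max FormQuot.{u} := ⟨Quotient.map₂ .sup fun _ _ h _ _ h' => .congr_sup h h'⟩
instance : Min FormQuot.{u} := ⟨Quotient.map₂ .inf fun _ _ h _ _ h' => .congr_inf h h'⟩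

/-- The modality on classes of formulas. -/
def diaFun : FormQuot.{u} → FormQuot.{u} := Quotient.map .dia fun _ _ h => .congr_dia h

theorem add_comm' (a b : FormQuot.{u}) : a + b = b + a := by
  induction a using ind; induction b using ind
  exact sound (.add_comm _ _)

theorem add_zero' (a : FormQuot.{u}) : a + 0 = a := by
  induction a using ind
  exact sound (.add_zero _)

theorem add_neg' (a : FormQuot.{u}) : a + -a = 0 := by
  induction a using ind
  exact sound (.add_neg _)

instance : AddCommGroup FormQuot.{u} where
  add_assoc a b c := by
    induction a using ind; induction b using ind; induction c using ind
    exact (sound (.add_assoc _ _ _)).symm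
  zero_add a := by rw [add_comm', add_zero']
  add_zero := add_zero'
  add_comm := add_comm'
  neg_add_cancel a := by rw [add_comm', add_neg']
  nsmul := nsmulRec
  zsmul := zsmulRec

instance : Module ℝ FormQuot.{u} := Module.ofMinimalAxioms
  (fun r a b => by
    induction a using ind; induction b using ind
    exact sound (.smul_add _ _ _))
  (fun r s a => by
    induction a using ind
    exact sound (.add_smul _ _ _))
  (fun r s a => by
    induction a using ind
    exact (sound (.smul_smul _ _ _)).symm)
  (fun a => by
    induction a using ind
    exact sound (.one_smul _))

instance : Lattice FormQuot.{u} := Lattice.mk'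
  (fun a b => by
    induction a using ind; induction b using ind
    exact sound (.sup_comm _ _))
  (fun a b c => by
    induction a using ind; induction b using ind; induction c using ind
    exact (sound (.sup_assoc _ _ _)).symm)
  (fun a b => by
    induction a using ind; induction b using ind
    exact sound (.inf_comm _ _))
  (fun a b c => by
    induction a using ind; induction b using ind; induction c using ind
    exact (sound (.inf_assoc _ _ _)).symm)
  (fun a b => by
    induction a using ind; induction b using ind
    exact sound (.sup_inf_self _ _))
  (fun a b => by
    induction a using ind; induction b using ind
    exact sound (.inf_sup_self _ _))

theorem mk_le {x y : Form.{u}} (h : Provable (.inf x y) x) : mk x ≤ mk y :=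
  inf_eq_left.1 (show mk x ⊓ mk y = mk x from sound h)

instance : IsOrderedAddMonoid FormQuot.{u} where
  add_le_add_left a b h c := by
    rw [← inf_eq_left.2 h]
    induction a using ind; induction b using ind; induction c using ind
    exact mk_le (.add_le _ _ _)

instance : IsOrderedModule ℝ FormQuot.{u} := by
  have : PosSMulMono ℝ FormQuot.{u} := ⟨fun r hr a b h => by
    rw [← inf_eq_left.2 h]
    induction a using ind; induction b using ind
    exact mk_le (.smul_le r hr _ _)⟩
  have : SMulPosMono ℝ FormQuot.{u} := ⟨fun a ha r s h => by
    have h1 : (0 : FormQuot.{u}) ≤ (s - r) • a := smul_nonneg (sub_nonneg.2 h) ha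
    rwa [sub_smul, sub_nonneg] at h1⟩
  exact {}

end FormQuot

/-- The modal Riesz space of formulas modulo provable equality. -/
def initRiesz : ModalRiesz.{u} where
  carrier := FormQuot.{u}
  unit := 1
  unit_nonneg := FormQuot.mk_le .zero_le_one
  dia :=
    { toFun := FormQuot.diaFun
      map_add' := fun a b => by
        have key : ∀ a b : FormQuot.{u}, FormQuot.diaFun ((1 : ℝ) • a + (1 : ℝ) • b) =
            (1 : ℝ) • FormQuot.diaFun a + (1 : ℝ) • FormQuot.diaFun b := fun a b => by
          induction a using FormQuot.ind; induction b using FormQuot.ind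
          exact FormQuot.sound (.dia_linear _ _ _ _)
        simpa only [one_smul] using key a b
      map_smul' := fun r a => by
        have key : ∀ a : FormQuot.{u}, FormQuot.diaFun (r • a + (0 : ℝ) • a) =
            r • FormQuot.diaFun a + (0 : ℝ) • FormQuot.diaFun a := fun a => by
          induction a using FormQuot.ind
          exact FormQuot.sound (.dia_linear _ _ _ _)
        simpa only [zero_smul, add_zero, RingHom.id_apply] using key a }
  dia_nonneg a := by
    induction a using FormQuot.ind
    exact FormQuot.mk_le (.zero_le_dia _)
  dia_unit_le := FormQuot.mk_le .dia_one_le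

/-- The class of a formula, as an element of `initRiesz`. -/
def formClass (x : Form.{u}) : initRiesz.{u} := FormQuot.mk x

theorem isStrongUnit_initRiesz : IsStrongUnit initRiesz.{u}.unit := by
  refine ⟨initRiesz.unit_nonneg, ?_⟩
  suffices h : ∀ x : Form.{u}, ∃ r : ℝ, 0 ≤ r ∧
      |formClass.{u} x| ≤ r • initRiesz.{u}.unit by
    intro a
    induction a using FormQuot.ind with
    | h x =>
      obtain ⟨r, hr, hx⟩ := h x
      obtain ⟨n, hn⟩ := exists_nat_ge r
      refine ⟨n, hx.trans ?_⟩
      rw [← Nat.cast_smul_eq_nsmul ℝ]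
      exact smul_le_smul_of_nonneg_right hn initRiesz.unit_nonneg
  have hmono : ∀ r s : ℝ, r ≤ s → r • initRiesz.{u}.unit ≤ s • initRiesz.{u}.unit := fun r s h =>
    smul_le_smul_of_nonneg_right h initRiesz.unit_nonneg
  intro x
  induction x with
  | zero =>
    refine ⟨0, le_rfl, ?_⟩
    change |(0 : initRiesz.{u})| ≤ _
    rw [abs_zero, zero_smul]
  | one =>
    refine ⟨1, zero_le_one, ?_⟩
    change |initRiesz.{u}.unit| ≤ _
    rw [abs_of_nonneg initRiesz.unit_nonneg, one_smul]
  | add x y hx hy =>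
    obtain ⟨r, hr, hx⟩ := hx
    obtain ⟨s, hs, hy⟩ := hy
    refine ⟨r + s, add_nonneg hr hs, ?_⟩
    rw [add_smul]
    exact (abs_add_le _ _).trans (add_le_add hx hy)
  | smul c x hx =>
    obtain ⟨r, hr, hx⟩ := hx
    refine ⟨|c| * r, by positivity, ?_⟩
    rw [mul_smul]
    exact (abs_smul_le c (formClass x)).trans
      (smul_le_smul_of_nonneg_left hx (abs_nonneg c))
  | sup x y hx hy =>
    obtain ⟨r, hr, hx⟩ := hx
    obtain ⟨s, hs, hy⟩ := hy
    refine ⟨max r s, le_max_of_le_left hr, ?_⟩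
    change |formClass x ⊔ formClass y| ≤ _
    rw [abs_le'] at hx hy ⊢
    constructor
    · exact sup_le (hx.1.trans (hmono _ _ (le_max_left r s)))
        (hy.1.trans (hmono _ _ (le_max_right r s)))
    · exact (neg_le_neg le_sup_left).trans
        (hx.2.trans (hmono _ _ (le_max_left r s)))
  | inf x y hx hy =>
    obtain ⟨r, hr, hx⟩ := hx
    obtain ⟨s, hs, hy⟩ := hy
    refine ⟨max r s, le_max_of_le_left hr, ?_⟩
    change |formClass x ⊓ formClass y| ≤ _
    rw [abs_le'] at hx hy ⊢
    constructor
    · exact inf_le_left.trans (hx.1.trans (hmono _ _ (le_max_left r s)))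
    · refine neg_le.1 (le_inf ?_ ?_)
      · exact neg_le.1 (hx.2.trans (hmono _ _ (le_max_left r s)))
      · exact neg_le.1 (hy.2.trans (hmono _ _ (le_max_right r s)))
  | dia x hx =>
    obtain ⟨r, hr, hx⟩ := hx
    refine ⟨r, hr, (initRiesz.abs_dia_le (formClass x)).trans ((initRiesz.dia_mono hx).trans ?_)⟩
    rw [map_smul]
    exact smul_le_smul_of_nonneg_left initRiesz.dia_unit_le hr

/-! ### The quotient by the infinitely small elements -/

section ArchQuot

/-- The subspace of infinitely small elements. -/
def infSmall (A : ModalRiesz.{u}) : Submodule ℝ A where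
  carrier := {a | IsInfinitelySmall a}
  zero_mem' := ⟨0, fun n => by simp⟩
  add_mem' := by
    rintro a b ⟨c, hc⟩ ⟨d, hd⟩
    refine ⟨|c| + |d|, fun n => ?_⟩
    rw [abs_of_nonneg (add_nonneg (abs_nonneg c) (abs_nonneg d))]
    refine (nsmul_le_nsmul_right (abs_add_le a b) n).trans ?_
    rw [nsmul_add]
    exact add_le_add (hc n) (hd n)
  smul_mem' := by
    rintro r a ⟨c, hc⟩
    obtain ⟨N, hN⟩ := exists_nat_ge |r|
    refine ⟨c, fun n => le_trans ?_ (hc (n * N))⟩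
    rw [mul_nsmul']
    refine nsmul_le_nsmul_right ((abs_smul_le r a).trans ?_) n
    rw [← Nat.cast_smul_eq_nsmul ℝ]
    exact smul_le_smul_of_nonneg_right hN (abs_nonneg a)

variable (A : ModalRiesz.{u})

theorem infSmall_solid : IsRieszIdeal (infSmall A) := by
  rintro a b ⟨c, hc⟩ h
  exact ⟨c, fun n => (nsmul_le_nsmul_right h n).trans (hc n)⟩

theorem dia_mem_infSmall {a : A} (ha : a ∈ infSmall A) : A.dia a ∈ infSmall A := by
  obtain ⟨c, hc⟩ := ha
  refine ⟨A.dia |c|, fun n => ?_⟩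
  refine (nsmul_le_nsmul_right (A.abs_dia_le a) n).trans ?_
  rw [← map_nsmul]
  exact (A.dia_mono (hc n)).trans (le_abs_self _)

/-- The quotient by the congruence `a ≈ b ↔ a - b` is infinitely small. -/
abbrev ArchQuot : Type u := A ⧸ infSmall A

variable {A}

theorem infSmall_sub_iff {a b : A} :
    (infSmall A).quotientRel a b ↔ a - b ∈ infSmall A := Submodule.quotientRel_def _

theorem infSmall_congr {op : A → A → A} (hop : ∀ a b c, |op a c - op b c| ≤ |a - b|)
    (hcomm : ∀ a b, op a b = op b a) {a a' b b' : A} (h : a - a' ∈ infSmall A)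
    (h' : b - b' ∈ infSmall A) : op a b - op a' b' ∈ infSmall A := by
  have h1 : op a b - op a' b ∈ infSmall A := infSmall_solid A h (hop _ _ _)
  have h2 : op a' b - op a' b' ∈ infSmall A := by
    rw [hcomm a' b, hcomm a' b']
    exact infSmall_solid A h' (hop _ _ _)
  have := (infSmall A).add_mem h1 h2
  rwa [sub_add_sub_cancel] at this

instance : Max (ArchQuot A) := ⟨Quotient.map₂ (· ⊔ ·) fun _ _ h _ _ h' =>
  infSmall_sub_iff.2 (infSmall_congr (fun a b c => abs_sup_sub_sup_le_abs a b c)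
    (fun a b => sup_comm a b) (infSmall_sub_iff.1 h) (infSmall_sub_iff.1 h'))⟩

instance : Min (ArchQuot A) := ⟨Quotient.map₂ (· ⊓ ·) fun _ _ h _ _ h' =>
  infSmall_sub_iff.2 (infSmall_congr (fun a b c => abs_inf_sub_inf_le_abs a b c)
    (fun a b => inf_comm a b) (infSmall_sub_iff.1 h) (infSmall_sub_iff.1 h'))⟩

/-- The quotient map. -/
def ArchQuot.mk (a : A) : ArchQuot A := Submodule.Quotient.mk a

theorem ArchQuot.ind {p : ArchQuot A → Prop} (h : ∀ a : A, p (ArchQuot.mk a)) (x : ArchQuot A) :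
    p x := Quotient.ind h x

instance : Lattice (ArchQuot A) := Lattice.mk'
  (fun a b => by
    induction a using ArchQuot.ind; induction b using ArchQuot.ind
    exact congrArg ArchQuot.mk (sup_comm _ _))
  (fun a b c => by
    induction a using ArchQuot.ind; induction b using ArchQuot.ind; induction c using ArchQuot.ind
    exact congrArg ArchQuot.mk (sup_assoc _ _ _))
  (fun a b => by
    induction a using ArchQuot.ind; induction b using ArchQuot.ind
    exact congrArg ArchQuot.mk (inf_comm _ _))
  (fun a b c => by
    induction a using ArchQuot.ind; induction b using ArchQuot.ind; induction c using ArchQuot.ind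
    exact congrArg ArchQuot.mk (inf_assoc _ _ _))
  (fun a b => by
    induction a using ArchQuot.ind; induction b using ArchQuot.ind
    exact congrArg ArchQuot.mk sup_inf_self)
  (fun a b => by
    induction a using ArchQuot.ind; induction b using ArchQuot.ind
    exact congrArg ArchQuot.mk inf_sup_self)

theorem ArchQuot.mk_mono {a b : A} (h : a ≤ b) : ArchQuot.mk a ≤ ArchQuot.mk b :=
  inf_eq_left.1 (show ArchQuot.mk a ⊓ ArchQuot.mk b = _ from
    congrArg ArchQuot.mk (inf_eq_left.2 h))

theorem ArchQuot.exists_of_le {x y : ArchQuot A} (h : x ≤ y) :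
    ∃ a b : A, ArchQuot.mk a = x ∧ ArchQuot.mk b = y ∧ a ≤ b := by
  have h' := inf_eq_left.2 h
  induction x using ArchQuot.ind with
  | h a =>
  induction y using ArchQuot.ind with
  | h b => exact ⟨a ⊓ b, b, h', rfl, inf_le_right⟩

instance : IsOrderedAddMonoid (ArchQuot A) where
  add_le_add_left x y h z := by
    obtain ⟨a, b, rfl, rfl, hab⟩ := ArchQuot.exists_of_le h
    induction z using ArchQuot.ind
    exact ArchQuot.mk_mono (add_le_add_left hab _)

instance : IsOrderedModule ℝ (ArchQuot A) := by
  have : PosSMulMono ℝ (ArchQuot A) := ⟨fun r hr x y h => by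
    obtain ⟨a, b, rfl, rfl, hab⟩ := ArchQuot.exists_of_le h
    exact ArchQuot.mk_mono (smul_le_smul_of_nonneg_left hab hr)⟩
  have : SMulPosMono ℝ (ArchQuot A) := ⟨fun x hx r s h => by
    have h1 : 0 ≤ (s - r) • x := smul_nonneg (sub_nonneg.2 h) hx
    rwa [sub_smul, sub_nonneg] at h1⟩
  exact {}

variable (A) in
/-- The quotient of a modal Riesz space by its infinitely small elements. -/
def archQuot : ModalRiesz.{u} where
  carrier := ArchQuot A
  unit := ArchQuot.mk A.unit
  unit_nonneg := ArchQuot.mk_mono A.unit_nonneg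
  dia := (infSmall A).mapQ (infSmall A) A.dia fun _ h => dia_mem_infSmall A h
  dia_nonneg x := by
    induction x using ArchQuot.ind with
    | h a => exact ArchQuot.mk_mono (A.dia_nonneg a)
  dia_unit_le := ArchQuot.mk_mono A.dia_unit_le

theorem ArchQuot.mk_abs (a : A) : |ArchQuot.mk a| = ArchQuot.mk |a| := rfl

theorem isAU_archQuot (hA : IsStrongUnit A.unit) : ModalRiesz.isAU (archQuot A) := by
  have hu : IsStrongUnit (archQuot A).unit := by
    refine ⟨(archQuot A).unit_nonneg, fun x => ?_⟩
    induction x using ArchQuot.ind with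
    | h a =>
      obtain ⟨n, hn⟩ := hA.2 a
      exact ⟨n, ArchQuot.mk_mono hn⟩
  refine ⟨?_, hu⟩
  rintro x ⟨y, hxy⟩
  induction x using ArchQuot.ind with
  | h a =>
  obtain ⟨k, hk⟩ := hu.2 y
  refine (Submodule.Quotient.mk_eq_zero _).2 ⟨(k + 1) • A.unit, fun n => ?_⟩
  have h1 : ArchQuot.mk (n • |a| ⊓ k • A.unit) = ArchQuot.mk (n • |a|) :=
    inf_eq_left.2 (show ArchQuot.mk (n • |a|) ≤ ArchQuot.mk (k • A.unit) from (hxy n).trans hk)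
  have h2 : n • |a| ⊓ k • A.unit - n • |a| ∈ infSmall A :=
    (Submodule.Quotient.eq _).1 h1
  obtain ⟨c, hc⟩ := h2
  obtain ⟨m, hm⟩ := hA.2 c
  have h3 : |(n • |a| ⊓ k • A.unit - n • |a| : A)| ≤ A.unit := by
    rcases Nat.eq_zero_or_pos m with rfl | hm0
    · have := (hc 1).trans hm
      rw [one_nsmul, zero_nsmul] at this
      exact this.trans A.unit_nonneg
    · have h4 := (hc m).trans hm
      rw [← Nat.cast_smul_eq_nsmul ℝ, ← Nat.cast_smul_eq_nsmul ℝ m A.unit] at h4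
      have hm1 : (0 : ℝ) < m := by exact_mod_cast hm0
      have h5 := smul_le_smul_of_nonneg_left h4 (inv_nonneg.2 hm1.le)
      rwa [smul_smul, smul_smul, inv_mul_cancel₀ hm1.ne', one_smul, one_smul] at h5
  refine le_trans ?_ (le_abs_self _)
  rw [add_nsmul, one_nsmul]
  have h6 := (neg_le_abs _).trans h3
  rw [neg_sub, sub_le_iff_le_add'] at h6
  exact h6.trans (add_le_add_left inf_le_right _)

end ArchQuot

/-- The space `𝕀ₐ`: formulas modulo provable equality and modulo infinitely small elements. -/
def initArch : AURieszDia.{u} := ⟨archQuot initRiesz, isAU_archQuot isStrongUnit_initRiesz⟩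

/-! ### The functors between modal Riesz spaces and Markov processes, on objects -/

/-- For a maximal ideal `J` there is exactly one Radon subprobability measure `μ` on the spectrum
with `∫ â dμ = (◇a)^(J)` for all `a`. -/
theorem exists_unique_radon (A : AURieszDia.{u}) (J : Spec A.obj) :
    ∃! μ : RadonSub (Spec A.obj), ∀ a : A.obj,
      μ.expect (hat A.property.2 a) = J.value A.property.2 (A.obj.dia a) := by
  have hu := A.property.2
  have := Spec.compactSpace hu
  have := Spec.t2Space hu
  have hpos : ∀ a : A.obj, 0 ≤ hat hu a → 0 ≤ J.value hu (A.obj.dia a) := by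
    intro a ha
    refine le_of_forall_pos_le_add fun ε hε => ?_
    have h1 := J.value_mono hu (A.obj.dia_mono (hat_nonneg hu ha hε))
    have h2 := J.value_mono hu (A.obj.dia_unit_le)
    rw [map_zero, map_add, map_smul, J.value_add, J.value_smul,
      (J.value_eq_zero_iff hu).2 J.ideal.zero_mem] at h1
    rw [J.value_unit] at h2
    have := mul_le_mul_of_nonneg_left h2 hε.le
    linarith
  have hker : LinearMap.ker (hatLin hu) ≤ LinearMap.ker ((J.eval hu).comp A.obj.dia) := by
    intro a ha
    rw [LinearMap.mem_ker] at ha ⊢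
    have h1 := hpos a (ge_of_eq ha)
    have h2 := hpos (-a) (ge_of_eq (show hatLin hu (-a) = 0 by rw [map_neg, ha, neg_zero]))
    rw [map_neg, ← J.eval_apply hu, map_neg] at h2
    exact le_antisymm (neg_nonneg.1 h2) h1
  let f : C(Spec A.obj, ℝ) →ₗ.[ℝ] ℝ :=
    ⟨LinearMap.range (hatLin hu), ((LinearMap.ker (hatLin hu)).liftQ _ hker).comp
      (hatLin hu).quotKerEquivRange.symm.toLinearMap⟩
  have hf : ∀ (a : A.obj) (h : hatLin hu a ∈ f.domain),
      f ⟨hatLin hu a, h⟩ = J.value hu (A.obj.dia a) := by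
    intro a h
    change (LinearMap.ker (hatLin hu)).liftQ _ hker
      ((hatLin hu).quotKerEquivRange.symm ⟨hatLin hu a, h⟩) = _
    rw [LinearMap.quotKerEquivRange_symm_apply_image]
    rfl
  obtain ⟨F, hF1, hF2⟩ := riesz_extension (PointedCone.positive ℝ C(Spec A.obj, ℝ)) f
    (by
      rintro ⟨_, a, rfl⟩ h
      exact (hpos a h).trans_eq (hf a ⟨a, rfl⟩).symm)
    (by
      intro g
      refine ⟨⟨hatLin hu (‖g‖ • A.obj.unit), _, rfl⟩, ?_⟩
      intro K
      change 0 ≤ K.value hu (‖g‖ • A.obj.unit) + g K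
      rw [K.value_smul, K.value_unit, mul_one]
      have := (abs_le.1 (g.norm_coe_le_norm K)).1
      linarith)
  have hF : ∀ a : A.obj, F (hat hu a) = J.value hu (A.obj.dia a) := fun a => by
    rw [← hf a ⟨a, rfl⟩, ← hF1]
    rfl
  obtain ⟨μ, hμ⟩ := RadonSub.exists_of_functional F (fun g hg => hF2 g hg) (by
    have h1 : hat hu A.obj.unit = 1 := by
      ext K
      exact K.value_unit hu
    rw [← h1, hF, ← J.value_unit hu]
    exact J.value_mono hu A.obj.dia_unit_le)
  refine ⟨μ, fun a => by rw [hμ, hF], fun ν hν => RadonSub.ext_expect fun g => ?_⟩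
  refine eq_of_forall_dist_le fun ε hε => ?_
  obtain ⟨a, ha⟩ := exists_hat_close hu g (half_pos hε)
  have key : ∀ ρ : RadonSub (Spec A.obj), |ρ.expect g - ρ.expect (hat hu a)| ≤ ε / 2 := by
    intro ρ
    have h1 := ρ.abs_expect_le (g + (-1 : ℝ) • hat hu a) (half_pos hε).le (fun K => by
      have := (ha K).le
      simpa [sub_eq_add_neg] using this)
    rw [ρ.expect_add, ρ.expect_smul] at h1
    simpa [sub_eq_add_neg] using h1
  have h1 := key μ
  have h2 := key ν
  rw [hν] at h2
  rw [hμ (hat hu a), hF] at h1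
  rw [Real.dist_eq]
  rw [abs_le] at h1 h2 ⊢
  constructor <;> linarith

/-- The Radon subprobability measure `α(J)` on the spectrum assigned to a maximal ideal `J`: the
unique one with `∫ â dα(J) = (◇a)^(J)` for all `a`. -/
noncomputable def specTransition (A : AURieszDia.{u}) (J : Spec A.obj) : RadonSub (Spec A.obj) :=
  (exists_unique_radon A J).choose

theorem specTransition_expect (A : AURieszDia.{u}) (J : Spec A.obj) (a : A.obj) :
    (specTransition A J).expect (hat A.property.2 a) = J.value A.property.2 (A.obj.dia a) :=
  (exists_unique_radon A J).choose_spec.1 a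

theorem continuous_specTransition (A : AURieszDia.{u}) : Continuous (specTransition A) := by
  have hu := A.property.2
  have := Spec.compactSpace hu
  have := Spec.t2Space hu
  rw [RadonSub.continuous_iff]
  intro g
  refine continuous_of_uniform_approx_of_continuous fun V hV => ?_
  obtain ⟨ε, hε, hV⟩ := Metric.mem_uniformity_dist.1 hV
  obtain ⟨a, ha⟩ := exists_hat_close hu g (half_pos hε)
  refine ⟨fun J => J.value hu (A.obj.dia a), Spec.continuous_value hu _, fun J => hV ?_⟩
  change dist ((specTransition A J).expect g) (J.value hu (A.obj.dia a)) < ε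
  rw [← specTransition_expect, Real.dist_eq]
  have h1 := (specTransition A J).abs_expect_le (g + (-1 : ℝ) • hat hu a) (half_pos hε).le
    (fun K => by
      have := (ha K).le
      simpa [sub_eq_add_neg] using this)
  rw [RadonSub.expect_add, RadonSub.expect_smul, neg_one_mul, ← sub_eq_add_neg] at h1
  exact lt_of_le_of_lt h1 (half_lt_self hε)

/-- The Markov process `Spec^◇(A)` of an Archimedean unital modal Riesz space `A`. -/
noncomputable def specDia (A : AURieszDia.{u}) : Markov.{u} :=
  have := Spec.compactSpace A.property.2
  have := Spec.t2Space A.property.2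
  { V := CompHaus.of (Spec A.obj)
    str := ConcreteCategory.ofHom ⟨specTransition A, continuous_specTransition A⟩ }

/-- The modal Riesz space `(C(X), 1, ◇)` of a Markov process `α` on `X`, where
`(◇f)(x) = ∫ f dα(x)`. -/
noncomputable def contRiesz (M : Markov.{u}) : ModalRiesz.{u} where
  carrier := C(M.V, ℝ)
  unit := 1
  unit_nonneg := fun _ => zero_le_one
  dia :=
    { toFun := fun f => ⟨fun x => (transition M x).expect f,
        RadonSub.continuous_iff.1 (continuous_transition M) f⟩
      map_add' := fun f g => by ext x; exact (transition M x).expect_add f g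
      map_smul' := fun r f => by ext x; exact (transition M x).expect_smul r f }
  dia_nonneg f := fun x => (transition M x).expect_nonneg le_sup_right
  dia_unit_le := fun x => (transition M x).expect_one

theorem isCAU_contRiesz (M : Markov.{u}) : ModalRiesz.isCAU (contRiesz M) := by
  refine ⟨?_, ⟨(contRiesz M).unit_nonneg, ?_⟩, ?_⟩
  · rintro (f : C(M.V, ℝ)) ⟨(g : C(M.V, ℝ)), h⟩
    change f = 0
    ext x
    have h1 : ∀ n : ℕ, n • |f x| ≤ |g x| := fun n => h n x
    simp only [nsmul_eq_mul] at h1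
    by_contra hne
    have hpos : 0 < |f x| := abs_pos.2 hne
    obtain ⟨n, hn⟩ := exists_nat_gt (|g x| / |f x|)
    rw [div_lt_iff₀ hpos] at hn
    exact absurd (h1 n) (not_le.2 hn)
  · intro (f : C(M.V, ℝ))
    obtain ⟨n, hn⟩ := exists_nat_ge ‖f‖
    refine ⟨n, fun x => ?_⟩
    change |f x| ≤ n • (1 : ℝ)
    rw [nsmul_eq_mul, mul_one]
    exact (f.norm_coe_le_norm x).trans hn
  · intro (a : ℕ → C(M.V, ℝ)) ha
    have hb : ∀ (f : C(M.V, ℝ)) (ε : ℝ), 0 ≤ ε →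
        ((show contRiesz M from |f|) ≤ ε • (contRiesz M).unit ↔ ‖f‖ ≤ ε) := by
      intro f ε hε
      rw [ContinuousMap.norm_le _ hε]
      refine forall_congr' fun x => ?_
      change |f x| ≤ ε * 1 ↔ _
      rw [mul_one, Real.norm_eq_abs]
    have hC : CauchySeq a := by
      rw [Metric.cauchySeq_iff]
      intro ε hε
      obtain ⟨N, hN⟩ := ha (ε / 2) (half_pos hε)
      refine ⟨N + 1, fun i hi j hj => ?_⟩
      rw [dist_eq_norm]
      exact lt_of_le_of_lt ((hb _ _ (half_pos hε).le).1 (hN i hi j hj)) (half_lt_self hε)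
    obtain ⟨b, hlim⟩ := cauchySeq_tendsto_of_complete hC
    refine ⟨b, fun ε hε => ?_⟩
    obtain ⟨N, hN⟩ := Metric.tendsto_atTop.1 hlim ε hε
    refine ⟨N, fun n hn => (hb _ _ hε.le).2 ?_⟩
    have h1 := (hN n (le_of_lt hn)).le
    rw [dist_comm, dist_eq_norm] at h1
    exact h1

/-- `C^◇(α)`, as an object of the category of complete Archimedean unital modal Riesz spaces. -/
noncomputable def contDia (M : Markov.{u}) : CAURieszDia.{u} := ⟨contRiesz M, isCAU_contRiesz M⟩

end ModalRieszDuality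

namespace ModalRieszDuality

/-! ### Approximation in Archimedean unital Riesz spaces -/

section Approximation

variable {A : Type u} [AddCommGroup A] [Lattice A] [IsOrderedAddMonoid A] [Module ℝ A]

/-! The argument starts from the incomplete space `initArch`, where everything is forced by syntax.
A closed term has exactly one value in any modal Riesz space, and provably equal terms have equal
values (`Provable.eval_eq`). This gives a homomorphism from the term model, and it is the only one
(`initRiesz_hom_apply`). Infinitely small elements die in an Archimedean target, so the homomorphism
factors through `initArch`. Hence `initArch` has exactly one homomorphism into each Archimedean
modal Riesz space.

Finality follows by transporting this along spectra. Given a homomorphism `h` from `A` to the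
functions on a process, a state `x` determines the maximal ideal of those `a` for which `h a`
vanishes at `x`. This map of states is a coalgebra morphism into `specDia A`: the measure at a point
of the spectrum is the only one satisfying certain integral equations, and the pushforward of the
measure at `x` satisfies them (`toSpecDia`). Conversely, a coalgebra morphism into `specDia A` can
be recovered from the homomorphism it induces on `A` (`specDia_hom_ext`). With `A` equal to
`initArch`, there is always exactly one such homomorphism.

Initiality needs one more ingredient. The representation of `B` by functions on its spectrum is
injective when `B` is Archimedean (`hat_injective`), surjective when `B` is complete
(`hat_surjective`), and compatible with the modalities (`hatHom`). So a complete `B` is a copy of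
the functions on its own process, and pulling back along the coalgebra morphism between spectra
yields the required homomorphism. Uniqueness is by density: the elements of `initArch` approximate
every continuous function on its spectrum uniformly, and homomorphisms respect such approximations
(`contRiesz_specDia_hom_ext`). -/

theorem IsArchimedeanRiesz.eq_zero (hA : IsArchimedeanRiesz A) {u a : A} (hu : 0 ≤ u)
    (h : ∀ ε : ℝ, 0 < ε → |a| ≤ ε • u) : a = 0 := by
  refine hA a ⟨u, fun n => ?_⟩
  rw [abs_of_nonneg hu]
  -- The bound is taken at `ε = 1 / n`, so `n = 0` is treated apart.
  rcases Nat.eq_zero_or_pos n with rfl | hn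
  · rwa [zero_nsmul]
  · have hn' : (0 : ℝ) < n := by exact_mod_cast hn
    have h1 := nsmul_le_nsmul_right (h (n : ℝ)⁻¹ (inv_pos.2 hn')) n
    rwa [← Nat.cast_smul_eq_nsmul ℝ n ((n : ℝ)⁻¹ • u), smul_smul, mul_inv_cancel₀ hn'.ne',
      one_smul] at h1

variable [IsOrderedModule ℝ A]

/-- Order bounds in `A` can be read off the spectrum, because an element with nonnegative values is
nonnegative up to an arbitrarily small multiple of `u`. The slack `ε` cannot be dropped at this
generality: infinitely small elements have value `0` at every maximal ideal. The lemma transfers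
uniform estimates between `A` and its functions. -/
theorem abs_le_of_abs_hat_le {u : A} (hu : IsStrongUnit u) {a : A} {c : ℝ}
    (h : ∀ J : Spec A, |J.value hu a| ≤ c) {ε : ℝ} (hε : 0 < ε) : |a| ≤ (c + ε) • u := by
  have key : ∀ b : A, (∀ J : Spec A, J.value hu b ≤ c) → b ≤ (c + ε) • u := by
    intro b hb
    have h1 : 0 ≤ hat hu (c • u - b) := by
      intro J
      change 0 ≤ J.value hu (c • u - b)
      have := hb J
      rw [← J.eval_apply hu, map_sub, map_smul, J.eval_apply, J.eval_apply, J.value_unit,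
        smul_eq_mul, mul_one]
      linarith
    have h2 := hat_nonneg hu h1 hε
    rwa [sub_add_eq_add_sub, ← add_smul, sub_nonneg] at h2
  rw [abs_le']
  refine ⟨key a fun J => (le_abs_self _).trans (h J), key (-a) fun J => ?_⟩
  rw [← J.eval_apply hu, map_neg]
  exact (neg_le_abs _).trans (h J)

/-- If two elements have the same values, their difference is below `ε • u` for every positive `ε`,
and the Archimedean property kills it. -/
theorem hat_injective {u : A} (hu : IsStrongUnit u) (hA : IsArchimedeanRiesz A) :
    Function.Injective (hat hu) := by
  intro a b hab
  refine sub_eq_zero.1 (hA.eq_zero hu.1 fun ε hε => ?_)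
  have h := abs_le_of_abs_hat_le hu (a := a - b) (c := 0) (fun J => by
    have h1 : J.value hu a = J.value hu b := DFunLike.congr_fun hab J
    rw [← J.eval_apply hu, map_sub, J.eval_apply, J.eval_apply, h1, sub_self, abs_zero]) hε
  rwa [zero_add] at h

/-- The represented functions are uniformly dense. A sequence in `A` whose functions approach `g` is
`u`-uniformly Cauchy by `abs_le_of_abs_hat_le`, and its limit in `A` represents `g`. -/
theorem hat_surjective {u : A} (hu : IsStrongUnit u) (hA : IsUnifComplete u) :
    Function.Surjective (hat hu) := by
  intro g
  choose a ha using fun n : ℕ => exists_hat_close hu g (Nat.one_div_pos_of_nat (α := ℝ) (n := n))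
  have ha' : ∀ n J, |g J - J.value hu (a n)| < 1 / ((n : ℝ) + 1) := ha
  have hsmall : ∀ ε : ℝ, 0 < ε → ∃ N : ℕ, ∀ n > N, ∀ J, |g J - J.value hu (a n)| < ε := by
    intro ε hε
    obtain ⟨N, hN⟩ := exists_nat_one_div_lt hε
    refine ⟨N, fun n hn J => (ha' n J).trans (lt_of_le_of_lt ?_ hN)⟩
    exact Nat.one_div_le_one_div hn.le
  obtain ⟨b, hb⟩ := hA a fun ε hε => by
    -- Two approximations within `ε / 4` of `g` differ by at most `ε / 2` in value; the other `ε /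
    -- 2` pays for the slack in passing from values to order.
    obtain ⟨N, hN⟩ := hsmall (ε / 4) (by linarith)
    refine ⟨N, fun i hi j hj => ?_⟩
    have h := abs_le_of_abs_hat_le hu (a := a i - a j) (c := ε / 2) (fun J => by
      have h1 := abs_lt.1 (hN i hi J)
      have h2 := abs_lt.1 (hN j hj J)
      rw [← J.eval_apply hu, map_sub, J.eval_apply, J.eval_apply, abs_le]
      constructor <;> linarith) (half_pos hε)
    rwa [add_halves] at h
  refine ⟨b, ContinuousMap.ext fun J => eq_of_forall_dist_le fun ε hε => ?_⟩
  obtain ⟨N, hN⟩ := hsmall (ε / 2) (half_pos hε)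
  obtain ⟨N', hN'⟩ := hb (ε / 2) (half_pos hε)
  -- Both bounds hold for indices strictly beyond `N` and `N'`, hence the successor of the maximum.
  have h1 := abs_lt.1 (hN (max N N' + 1) (by omega) J)
  have h2 := J.value_mono hu (hN' (max N N' + 1) (by omega))
  rw [J.value_abs, J.value_smul, J.value_unit, mul_one, ← J.eval_apply hu, map_sub,
    J.eval_apply, J.eval_apply, abs_le] at h2
  rw [Real.dist_eq, abs_le]
  change -ε ≤ J.value hu b - g J ∧ J.value hu b - g J ≤ ε
  constructor <;> linarith

end Approximation

/-! ### Homomorphisms -/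

namespace ModalRiesz.Hom

variable {A B C : ModalRiesz.{u}}

theorem map_abs (f : Hom A B) (a : A) : f.toLin |a| = |f.toLin a| := by
  change f.toLin (a ⊔ -a) = _
  rw [f.map_sup, map_neg]
  rfl

theorem mono (f : Hom A B) {a b : A} (h : a ≤ b) : f.toLin a ≤ f.toLin b := by
  rw [← inf_eq_left, ← f.map_inf, inf_eq_left.2 h]

/-- Composition of homomorphisms, in applicative order. -/
def comp (g : Hom B C) (f : Hom A B) : Hom A C :=
  ((show A ⟶ B from f) ≫ (show B ⟶ C from g) : A ⟶ C)

/-- The inverse of a bijective homomorphism. -/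
noncomputable def inverse (f : Hom A B) (hf : Function.Bijective f.toLin) : Hom B A where
  toLin := (LinearEquiv.ofBijective f.toLin hf).symm
  -- Each identity for the inverse is tested after applying the injective map `f`, which already
  -- preserves the structure.
  map_sup a b := hf.1 (by
    rw [f.map_sup]
    simp only [LinearEquiv.coe_coe, LinearEquiv.apply_ofBijective_symm_apply])
  map_inf a b := hf.1 (by
    rw [f.map_inf]
    simp only [LinearEquiv.coe_coe, LinearEquiv.apply_ofBijective_symm_apply])
  map_unit := hf.1 (by
    rw [f.map_unit]
    simp only [LinearEquiv.coe_coe, LinearEquiv.apply_ofBijective_symm_apply])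
  map_dia a := hf.1 (by
    rw [f.map_dia]
    simp only [LinearEquiv.coe_coe, LinearEquiv.apply_ofBijective_symm_apply])

/-- If `b` witnesses that `a` is infinitely small, then its image witnesses the same for the image
of `a`, by monotonicity; an Archimedean target leaves only `0`. -/
theorem infSmall_le_ker (f : Hom A B) (hB : IsArchimedeanRiesz B) :
    infSmall A ≤ LinearMap.ker f.toLin := by
  rintro a ⟨b, hb⟩
  refine hB _ ⟨f.toLin b, fun n => ?_⟩
  rw [← f.map_abs, ← f.map_abs, ← map_nsmul]
  exact f.mono (hb n)

/-- A homomorphism to an Archimedean space factors through the Archimedean quotient. -/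
def archLift (f : Hom A B) (hB : IsArchimedeanRiesz B) : Hom (archQuot A) B where
  toLin := (infSmall A).liftQ f.toLin (f.infSmall_le_ker hB)
  map_sup x y := by
    induction x using ArchQuot.ind; induction y using ArchQuot.ind
    exact f.map_sup _ _
  map_inf x y := by
    induction x using ArchQuot.ind; induction y using ArchQuot.ind
    exact f.map_inf _ _
  map_unit := f.map_unit
  map_dia x := by
    induction x using ArchQuot.ind
    exact f.map_dia _

end ModalRiesz.Hom

/-! ### Interpretation of formulas -/

/-- The interpretation of a formula in a modal Riesz space. -/
def Form.eval (A : ModalRiesz.{u}) : Form.{u} → A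
  | .zero => 0
  | .one => A.unit
  | .add x y => x.eval A + y.eval A
  | .smul r x => r • x.eval A
  | .sup x y => x.eval A ⊔ y.eval A
  | .inf x y => x.eval A ⊓ y.eval A
  | .dia x => A.dia (x.eval A)

/-- Soundness of the equational calculus: its rules preserve equality of values, and each axiom
holds in every modal Riesz space. It makes interpretation well defined on classes of formulas. -/
theorem Provable.eval_eq (A : ModalRiesz.{u}) {x y : Form.{u}} (h : Provable x y) :
    x.eval A = y.eval A := by
  induction h with
  | refl => rfl
  | symm _ h => exact h.symm
  | trans _ _ h h' => exact h.trans h'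
  | congr_add _ _ h h' => exact congrArg₂ (· + ·) h h'
  | congr_smul r _ h => exact congrArg (r • ·) h
  | congr_sup _ _ h h' => exact congrArg₂ (· ⊔ ·) h h'
  | congr_inf _ _ h h' => exact congrArg₂ (· ⊓ ·) h h'
  | congr_dia _ h => exact congrArg A.dia h
  | add_assoc => exact (_root_.add_assoc _ _ _).symm
  | add_comm => exact _root_.add_comm _ _
  | add_zero => exact _root_.add_zero _
  | add_neg x =>
    change x.eval A + (-1 : ℝ) • x.eval A = 0
    rw [neg_one_smul, add_neg_cancel]
  | smul_smul => exact _root_.smul_smul _ _ _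
  | one_smul => exact _root_.one_smul ℝ _
  | smul_add => exact _root_.smul_add _ _ _
  | add_smul => exact _root_.add_smul _ _ _
  | sup_assoc => exact (_root_.sup_assoc _ _ _).symm
  | inf_assoc => exact (_root_.inf_assoc _ _ _).symm
  | sup_comm => exact _root_.sup_comm _ _
  | inf_comm => exact _root_.inf_comm _ _
  | sup_inf_self => exact _root_.sup_inf_self
  | inf_sup_self => exact _root_.inf_sup_self
  | sup_idem => exact _root_.sup_idem _
  | inf_idem => exact _root_.inf_idem _
  -- The axioms from here on that express inequalities are written as meet equations, so
  -- `inf_eq_left` turns them back into order statements.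
  | add_le => exact inf_eq_left.2 (add_le_add_left inf_le_right _)
  | smul_le r hr => exact inf_eq_left.2 (smul_le_smul_of_nonneg_left inf_le_right hr)
  | zero_le_one => exact inf_eq_left.2 A.unit_nonneg
  | dia_linear r s x y =>
    change A.dia (r • x.eval A + s • y.eval A) = r • A.dia (x.eval A) + s • A.dia (y.eval A)
    rw [map_add, map_smul, map_smul]
  | zero_le_dia => exact inf_eq_left.2 (A.dia_nonneg _)
  | dia_one_le => exact inf_eq_left.2 A.dia_unit_le

/-- The homomorphism from the term model given by interpretation of formulas. -/
def initRieszHom (A : ModalRiesz.{u}) : ModalRiesz.Hom initRiesz.{u} A where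
  toLin :=
    { toFun := Quotient.lift (Form.eval A) fun _ _ h => h.eval_eq A
      map_add' := fun a b => by
        induction a using FormQuot.ind; induction b using FormQuot.ind
        rfl
      map_smul' := fun r a => by
        induction a using FormQuot.ind
        rfl }
  map_sup a b := by
    induction a using FormQuot.ind; induction b using FormQuot.ind
    rfl
  map_inf a b := by
    induction a using FormQuot.ind; induction b using FormQuot.ind
    rfl
  map_unit := rfl
  map_dia a := by
    induction a using FormQuot.ind
    rfl

/-- A homomorphism commutes with every term constructor, so induction on the formula leaves it no
freedom. This is the source of all uniqueness below. -/
theorem initRiesz_hom_apply {A : ModalRiesz.{u}} (f : ModalRiesz.Hom initRiesz.{u} A)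
    (x : Form.{u}) : f.toLin (formClass x) = x.eval A := by
  induction x with
  | zero => exact map_zero f.toLin
  | one => exact f.map_unit
  | add x y hx hy => exact (map_add f.toLin _ _).trans (congrArg₂ (· + ·) hx hy)
  | smul r x hx => exact (map_smul f.toLin r _).trans (congrArg (r • ·) hx)
  | sup x y hx hy => exact (f.map_sup _ _).trans (congrArg₂ (· ⊔ ·) hx hy)
  | inf x y hx hy => exact (f.map_inf _ _).trans (congrArg₂ (· ⊓ ·) hx hy)
  | dia x hx => exact (f.map_dia _).trans (congrArg A.dia hx)

/-- The homomorphism from the space of formulas modulo infinitely small elements to an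
Archimedean modal Riesz space. -/
def initArchHom (A : ModalRiesz.{u}) (hA : IsArchimedeanRiesz A) :
    ModalRiesz.Hom initArch.{u}.obj A :=
  (initRieszHom A).archLift hA

/-- Every element of `initArch` comes from a formula through two surjective quotients, so
precomposing with the second one reduces the claim to the term model. -/
theorem initArch_hom_ext {A : ModalRiesz.{u}} (f g : ModalRiesz.Hom initArch.{u}.obj A) :
    f = g := by
  let q : ModalRiesz.Hom initRiesz.{u} initArch.{u}.obj :=
    ⟨(infSmall initRiesz.{u}).mkQ, fun _ _ => rfl, fun _ _ => rfl, rfl, fun _ => rfl⟩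
  refine ModalRiesz.Hom.ext (LinearMap.ext fun a => ?_)
  induction a using ArchQuot.ind with
  | h a =>
  induction a using FormQuot.ind with
  | h x => exact (initRiesz_hom_apply (f.comp q) x).trans (initRiesz_hom_apply (g.comp q) x).symm

/-! ### The correspondence between homomorphisms and coalgebra morphisms -/

/-- Pulling back continuous functions along a coalgebra morphism. -/
noncomputable def contRieszMap {M N : Markov.{u}} (f : M ⟶ N) :
    ModalRiesz.Hom (contRiesz N) (contRiesz M) where
  toLin :=
    { toFun := fun g : C(N.V, ℝ) => g.comp (ConcreteCategory.hom f.f : C(M.V, N.V))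
      map_add' := fun _ _ => rfl
      map_smul' := fun _ _ => rfl }
  map_sup _ _ := rfl
  map_inf _ _ := rfl
  map_unit := rfl
  map_dia (g : C(N.V, ℝ)) := by
    refine ContinuousMap.ext fun x => ?_
    -- This is the coalgebra square at the state `x`; compatibility with the modality is then the
    -- change of variables formula for the pushforward.
    have h : (transition M x).map (ConcreteCategory.hom f.f : C(M.V, N.V)) =
        transition N (f.f x) := ConcreteCategory.congr_hom f.h x
    change (transition N (f.f x)).expect g = (transition M x).expect (g.comp _)
    rw [← h, RadonSub.expect_map]

/-- The representation of the elements of an Archimedean unital modal Riesz space as continuous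
functions on the spectrum. -/
noncomputable def hatHom (A : AURieszDia.{u}) :
    ModalRiesz.Hom A.obj (contRiesz (specDia A)) where
  toLin := hatLin A.property.2
  map_sup a b := ContinuousMap.ext fun J : Spec A.obj => J.value_sup A.property.2 a b
  map_inf a b := ContinuousMap.ext fun J : Spec A.obj => J.value_inf A.property.2 a b
  map_unit := ContinuousMap.ext fun J : Spec A.obj => J.value_unit A.property.2
  -- The equation that characterises the measure at `J` is exactly preservation of the modality.
  map_dia a := ContinuousMap.ext fun J : Spec A.obj => (specTransition_expect A J a).symm

/-! ### Extension from a dense subspace -/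

/-- Homomorphisms from `C^◇(Spec^◇(A))` to an Archimedean space are determined by their
restrictions to `A`. -/
theorem contRiesz_specDia_hom_ext {A : AURieszDia.{u}} {B : ModalRiesz.{u}}
    (hB : IsArchimedeanRiesz B) {f g : ModalRiesz.Hom (contRiesz (specDia A)) B}
    (h : f.comp (hatHom A) = g.comp (hatHom A)) : f = g := by
  refine ModalRiesz.Hom.ext (LinearMap.ext fun k => ?_)
  refine sub_eq_zero.1 (hB.eq_zero B.unit_nonneg fun ε hε => ?_)
  obtain ⟨a, ha⟩ := exists_hat_close A.property.2 (show C(Spec A.obj, ℝ) from k) (half_pos hε)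
  -- A homomorphism is monotone and preserves the absolute value and the unit, so it carries a
  -- uniform bound on functions to the same bound in `B`.
  have key : ∀ φ : ModalRiesz.Hom (contRiesz (specDia A)) B,
      |φ.toLin k - φ.toLin ((hatHom A).toLin a)| ≤ (ε / 2) • B.unit := by
    intro φ
    rw [← map_sub, ← φ.map_abs, ← φ.map_unit, ← map_smul]
    refine φ.mono fun J => ?_
    refine (ha J).le.trans ?_
    change ε / 2 ≤ ε / 2 * 1
    rw [mul_one]
  have hfg : f.toLin ((hatHom A).toLin a) = g.toLin ((hatHom A).toLin a) :=
    congrArg (fun φ : ModalRiesz.Hom A.obj B => φ.toLin a) h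
  have h1 := key f
  have h2 := key g
  rw [hfg] at h1
  rw [abs_sub_comm] at h2
  -- The images of `k` under `f` and `g` are compared through the common image of the approximating
  -- `a`.
  rw [← sub_add_sub_cancel _ (g.toLin ((hatHom A).toLin a))]
  refine (abs_add_le _ _).trans ((add_le_add h1 h2).trans_eq ?_)
  rw [← add_smul, add_halves]

/-! ### States of a process as points of a spectrum -/

/-- An element of `C^◇(α)`, as a continuous function. -/
def contFun {M : Markov.{u}} (g : contRiesz M) : C(M.V, ℝ) := g

/-- The maximal ideal of the elements whose associated function vanishes at a given state. -/
noncomputable def specPoint {A : AURieszDia.{u}} {M : Markov.{u}} (h : ModalRiesz.Hom A.obj (contRiesz M))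
    (x : M.V) : Spec A.obj :=
  -- Evaluation at `x` after `h` is a unital Riesz homomorphism to the reals, so its kernel is a
  -- maximal ideal.
  Spec.ofHom (u := A.obj.unit)
    { toFun := fun a => contFun (h.toLin a) x
      map_add' := fun a b => by rw [map_add]; rfl
      map_smul' := fun r a => by rw [map_smul]; rfl }
    (by
      change contFun (h.toLin A.obj.unit) x = 1
      rw [h.map_unit]
      rfl)
    (fun a => by
      change contFun (h.toLin |a|) x = _
      rw [h.map_abs]
      rfl)

/-- Since `h` preserves the unit, `r • u - a` vanishes at `x` precisely for `r` the value of `h a`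
there. Thus pulling `â` back along `specPoint h` returns `h a`, which drives both the continuity and
the coalgebra property of this map. -/
theorem specPoint_value {A : AURieszDia.{u}} {M : Markov.{u}}
    (h : ModalRiesz.Hom A.obj (contRiesz M)) (x : M.V) (a : A.obj) :
    (specPoint h x).value A.property.2 a = contFun (h.toLin a) x := by
  refine Spec.value_eq A.property.2 _ ?_
  change contFun (h.toLin (contFun (h.toLin a) x • A.obj.unit - a)) x = 0
  rw [map_sub, map_smul, h.map_unit]
  change contFun (h.toLin a) x * 1 - contFun (h.toLin a) x = 0
  rw [mul_one, sub_self]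

/-- Continuity into the spectrum can be tested on the functions `â`, whose pullbacks are the
continuous functions `h a`. -/
theorem continuous_specPoint {A : AURieszDia.{u}} {M : Markov.{u}}
    (h : ModalRiesz.Hom A.obj (contRiesz M)) : Continuous (specPoint h) := by
  have hu := A.property.2
  have := Spec.compactSpace hu
  have := Spec.t2Space hu
  -- The hull-kernel topology is defined by ideals, not by functions. The values give a continuous
  -- injection of a compact space into a Hausdorff one, hence an embedding, so the two topologies
  -- agree.
  have hemb : Topology.IsInducing fun (J : Spec A.obj) (a : A.obj) => J.value hu a := by
    refine (Continuous.isClosedEmbedding (continuous_pi fun a => Spec.continuous_value hu a)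
      fun J K hJK => ?_).isInducing
    ext a
    rw [← J.value_eq_zero_iff hu, ← K.value_eq_zero_iff hu]
    exact iff_of_eq (congrArg (· = 0) (congrFun hJK a))
  rw [hemb.continuous_iff, continuous_pi_iff]
  intro a
  simp only [Function.comp_def, specPoint_value]
  exact (contFun (h.toLin a)).continuous

/-- The coalgebra morphism to `Spec^◇(A)` that corresponds to a homomorphism from `A` to the
space of continuous functions on a Markov process. -/
noncomputable def toSpecDia {A : AURieszDia.{u}} {M : Markov.{u}}
    (h : ModalRiesz.Hom A.obj (contRiesz M)) : M ⟶ specDia A where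
  f := ConcreteCategory.ofHom (C := CompHaus.{u}) (Y := (specDia A).V)
    (⟨specPoint h, continuous_specPoint h⟩ : C(M.V, Spec A.obj))
  h := by
    have := Spec.compactSpace A.property.2
    have := Spec.t2Space A.property.2
    refine ConcreteCategory.hom_ext _ _ fun x => ?_
    change (transition M x).map (⟨specPoint h, continuous_specPoint h⟩ : C(M.V, Spec A.obj)) =
      specTransition A (specPoint h x)
    -- Commutation of the square is an equality of measures, and uniqueness reduces it to integrals
    -- of the functions `â` against the pushforward.
    refine (exists_unique_radon A (specPoint h x)).unique (fun a => ?_)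
      (specTransition_expect A (specPoint h x))
    rw [RadonSub.expect_map, specPoint_value, h.map_dia]
    change _ = (transition M x).expect (contFun (h.toLin a))
    congr 1
    exact ContinuousMap.ext fun y => specPoint_value h y a

/-- A coalgebra morphism to `Spec^◇(A)` is determined by the corresponding homomorphism. -/
theorem specDia_hom_ext {A : AURieszDia.{u}} {M : Markov.{u}} {f g : M ⟶ specDia A}
    (h : (contRieszMap f).comp (hatHom A) = (contRieszMap g).comp (hatHom A)) : f = g := by
  have hu := A.property.2
  refine Endofunctor.Coalgebra.ext (ConcreteCategory.hom_ext _ _ fun x => ?_)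
  -- A maximal ideal is the set of elements with value `0`, so equal values at the two image points
  -- suffice.
  refine Spec.ext (Submodule.ext fun a => ?_)
  change a ∈ (show Spec A.obj from f.f x).ideal ↔ a ∈ (show Spec A.obj from g.f x).ideal
  rw [← Spec.value_eq_zero_iff hu, ← Spec.value_eq_zero_iff hu]
  -- The hypothesis is evaluated at `a` and then at the state `x`: the pullback of `â` at `x` is the
  -- value of `a` at the image of `x`.
  have h1 : (show Spec A.obj from f.f x).value hu a = (show Spec A.obj from g.f x).value hu a :=
    DFunLike.congr_fun (congrArg (fun φ : ModalRiesz.Hom A.obj (contRiesz M) => contFun (φ.toLin a)) h) x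
  exact iff_of_eq (congrArg (· = 0) h1)

/-! ### Initiality and finality -/

/-- `Spec^◇(𝕀ₐ)` is a final coalgebra. -/
noncomputable def specDiaInitArchIsTerminal :
    Limits.IsTerminal (specDia initArch.{u}) :=
  Limits.IsTerminal.ofUniqueHom
    (fun M => toSpecDia (initArchHom (contRiesz M) (isCAU_contRiesz M).1))
    -- Any two coalgebra morphisms induce homomorphisms out of `initArch` with the same target, and
    -- these coincide.
    (fun _ _ => specDia_hom_ext (initArch_hom_ext _ _))

/-- The homomorphism from `C^◇(Spec^◇(𝕀ₐ))` to a complete space: the pullback along the map of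
spectra, followed by the inverse of the representation isomorphism. -/
noncomputable def contDiaInitArchHom (B : CAURieszDia.{u}) :
    ModalRiesz.Hom (contRiesz (specDia initArch.{u})) B.obj :=
  -- Completeness is forgotten so that the spectrum of `B` can be formed; it returns in the
  -- surjectivity that makes `hatHom B'` invertible.
  let B' : AURieszDia.{u} := ⟨B.obj, B.property.1, B.property.2.1⟩
  ((hatHom B').inverse ⟨hat_injective B.property.2.1 B.property.1,
    hat_surjective B.property.2.1 B.property.2.2⟩).comp
    (contRieszMap (toSpecDia ((hatHom B').comp (initArchHom B.obj B.property.1))))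

/-- `C^◇(Spec^◇(𝕀ₐ))` is an initial complete Archimedean unital modal Riesz space. -/
noncomputable def contDiaInitArchIsInitial :
    Limits.IsInitial (contDia (specDia initArch.{u})) :=
  Limits.IsInitial.ofUniqueHom
    (fun B => ObjectProperty.homMk (contDiaInitArchHom B))
    (fun B _ => ObjectProperty.hom_ext _
      -- By density it is enough to compare restrictions to `initArch`, where uniqueness is already
      -- known.
      (contRiesz_specDia_hom_ext B.property.1 (initArch_hom_ext _ _)))

end ModalRieszDuality

theorem proposition5p7 :
    Nonempty (Limits.IsInitial (ModalRieszDuality.contDia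
      (ModalRieszDuality.specDia ModalRieszDuality.initArch.{u}))) ∧
    Nonempty (Limits.IsTerminal
      (ModalRieszDuality.specDia ModalRieszDuality.initArch.{u})) :=
  ⟨⟨ModalRieszDuality.contDiaInitArchIsInitial⟩, ⟨ModalRieszDuality.specDiaInitArchIsTerminal⟩⟩
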